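/- Let $\Omega\subset\mathbb R^2$ be a bounded polygonal domain (open, connected, $\Omega=\operatorname{int}\overline\Omega$, $\partial\Omega$ a finite union of segments). Let $\epsilon>0$ be a constant, let $\alpha$ be a measurable function with $0<\alpha_{\min}\le\alpha\le\alpha_{\max}$ a.e. in $\Omega$, and let $\bm f\in L^2(\Omega)^2$, $g\in L^2(\Omega)$, $k\ge 0$. Meshes. Let $\mathcal T_u$ be a finite partition of $\overline\Omega$ into polygons (with at least three vertices; hanging nodes count as vertices), each with a chosen interior point $\nu$, such that joining each $\nu$ to all vertices of its polygon $S(\nu)$ cuts $S(\nu)$ into nondegenerate triangles (one for each side of $S(\nu)$), and all these triangles form a conforming triangulation $\mathcal T_h$ of $\overline\Omega$. Let $\mathcal F_u$ be the set of primal edges (sides of the polygons), $\mathcal F_u^0$ the set of those not contained in $\partial\Omega$, and $\mathcal F_p$ the set of dual edges (segments from a point $\nu$ to a vertex of $S(\nu)$). On each edge $e$ fix a unit normal $\bm n$, pointing out of $\Omega$ if $e\subset\partial\Omega$, and let $\bm t$ be the corresponding unit tangent. If $\tau_i\in\mathcal T_h$ are the (one or two) triangles that have the edge $e$, with outward unit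 normals $\bm n_i$ on $e$, and $\phi_i$ is the trace of $\phi|_{\tau_i}$ on $e$, the jump is $[\phi]=\sum_i(\bm n_i\cdot\bm n)\,\phi_i$. The element-wise gradient and (row-wise) divergence are $\nabla_h$ and $\mathrm{div}_h$, with $(\nabla \bm v)_{ij}=\partial_j v_i$, and $(\cdot,\cdot)$ is the $L^2(\Omega)$ inner product. Spaces. With $P^k$ the polynomials of degree at most $k$, let $$U^h=\{\bm v:\ \bm v|_\tau\in P^k(\tau)^2\ \forall\tau\in\mathcal T_h,\ \bm v\cdot\bm n\text{ continuous over each }e\in\mathcal F_p\},$$ $$W^h=\{G:\ G|_\tau\in P^k(\tau)^{2\times2}\ \forall\tau\in\mathcal T_h,\ G\bm n\text{ continuous over each }e\in\mathcal F_u^0\},$$ $$P^h=\{q:\ q|_\tau\in P^k(\tau)\ \forall\tau\in\mathcal T_h,\ q\text{ continuous over each }e\in\mathcal F_u^0,\ \textstyle\int_\Omega q\,dx=0\},$$ $$\widehat U^h=\{\widehat{\bm v}:\ \widehat{\bm v}|_e\in P^k(e)^2,\ \widehat{\bm v}\cdot\bm n|_e=0\ \forall e\in\mathcal F_p\}.$$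 Bilinear forms. Let $$B_h^*(\bm v,G)=-\int_\Omega\bm v\cdot\mathrm{div}_hG\,dx+\sum_{e\in\mathcal F_p}\int_e(\bm v\cdot\bm n)\,\bm n\cdot[G\bm n]\,ds,$$ $$B_h(G,\bm v)=\int_\Omega G:\nabla_h\bm v\,dx-\sum_{e\in\mathcal F_u}\int_e[\bm v]\cdot(G\bm n)\,ds-\sum_{e\in\mathcal F_p}\int_e[(\bm v\cdot\bm t)\,\bm t\cdot(G\bm n)]\,ds,$$ $$T_h^*(\widehat{\bm v},G)=T_h(G,\widehat{\bm v})=\sum_{e\in\mathcal F_p}\int_e[G\bm n]\cdot\widehat{\bm v}\,ds,$$ $$b_h^*(q,\bm v)=-\int_\Omega q\,\mathrm{div}_h\bm v\,dx+\sum_{e\in\mathcal F_u}\int_e q\,[\bm v\cdot\bm n]\,ds,\qquad b_h(\bm v,q)=\int_\Omega\bm v\cdot\nabla_hq\,dx-\sum_{e\in\mathcal F_p}\int_e(\bm v\cdot\bm n)\,[q]\,ds.$$ Theorem (existence and uniqueness). There is exactly one $(L_h,\bm u_h,\widehat{\bm u}_h,p_h)\in W^h\times U^h\times\widehat U^h\times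 P^h$ such that $$\begin{aligned}(L_h,G)&=\sqrt\epsilon\,B_h^*(\bm u_h,G)+\sqrt\epsilon\,T_h^*(\widehat{\bm u}_h,G)&&\forall G\in W^h,\\ \sqrt\epsilon\,B_h(L_h,\bm v)+(\alpha\bm u_h,\bm v)+b_h^*(p_h,\bm v)&=(\bm f,\bm v)&&\forall\bm v\in U^h,\\ -b_h(\bm u_h,q)&=(g,q)&&\forall q\in P^h,\\ T_h(L_h,\widehat{\bm v})&=0&&\forall\widehat{\bm v}\in\widehat U^h.\end{aligned}$$ -/

import Mathlib

open MeasureTheory Matrix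

noncomputable section

namespace SDG

/-- The Euclidean plane. -/
abbrev Plane : Type := EuclideanSpace ℝ (Fin 2)

/-- Polynomials in the two coordinates. A polynomial function on a nondegenerate triangle is
represented by the unique polynomial that induces it. -/
abbrev Poly : Type := MvPolynomial (Fin 2) ℝ

/-! ### Plane geometry -/

/-- The outward unit normal, on the edge with endpoints `a`, `b`, of the triangle `a b c`. -/
def outwardNormal (a b c : Plane) : Fin 2 → ℝ :=
  let m : Fin 2 → ℝ := (dist a b)⁻¹ • ![(b - a) 1, -((b - a) 0)]
  if m ⬝ᵥ (c - a).ofLp < 0 then m else -m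

/-- `n` is one of the two unit normals of the segment with endpoints `a`, `b`. -/
def IsUnitNormal (n : Fin 2 → ℝ) (a b : Plane) : Prop :=
  n ⬝ᵥ n = 1 ∧ n ⬝ᵥ (b - a).ofLp = 0

/-- The unit tangent vector that corresponds to a unit normal. -/
def tangent (n : Fin 2 → ℝ) : Fin 2 → ℝ := ![-(n 1), n 0]

/-- An edge, given by its two endpoints, as a subset of the plane. -/
def edgeSet (e : Sym2 Plane) : Set Plane := convexHull ℝ {x | x ∈ e}

/-- `∫_{[a,b]} φ ds`, by the constant speed parametrization of the segment. -/
def segIntegral (φ : Plane → ℝ) (a b : Plane) : ℝ :=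
  dist a b * ∫ s in (0 : ℝ)..1, φ (AffineMap.lineMap a b s)

theorem segIntegral_symm (φ : Plane → ℝ) (a b : Plane) :
    segIntegral φ a b = segIntegral φ b a := by
  unfold segIntegral
  rw [dist_comm]
  congr 1
  have h := intervalIntegral.integral_comp_sub_left (a := (0 : ℝ)) (b := 1)
    (fun s => φ (AffineMap.lineMap b a s)) 1
  simpa [AffineMap.lineMap_apply_one_sub] using h

/-- The integral `∫_e φ ds` with respect to arc length over an edge. -/
def edgeIntegral (e : Sym2 Plane) (φ : Plane → ℝ) : ℝ :=
  Sym2.lift ⟨segIntegral φ, segIntegral_symm φ⟩ e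

/-- The affine parameter of a point `x` of the segment from `a` to `b`:
it is `0` at `a` and `1` at `b`. -/
def edgeParam (a b x : Plane) : ℝ := inner ℝ (x - a) (b - a) / ‖b - a‖ ^ 2

/-- A bounded polygonal domain: open, connected, bounded, equal to the interior of its closure
(no slits), with boundary a finite union of segments. -/
structure IsPolygonalDomain (Ω : Set Plane) : Prop where
  isOpen : IsOpen Ω
  isConnected : IsConnected Ω
  isBounded : Bornology.IsBounded Ω
  interior_closure : interior (closure Ω) = Ω
  polygonal : ∃ s : Finset (Sym2 Plane), frontier Ω = ⋃ e ∈ s, edgeSet e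

/-! ### Meshes -/

/-- A primal polygonal mesh of `Ω`, with an interior point in each cell. The cell `c` is a polygon
with the vertices `vertex c 0, …, vertex c (sides c - 1)` in cyclic order (hanging nodes count as
vertices; angles of 180 degrees are allowed), and it is cut into triangles by joining its interior
point `center c` to all its vertices. The resulting triangles form a conforming triangulation of
`closure Ω`. -/
structure Mesh (Ω : Set Plane) where
  /-- the primal cells -/
  Cell : Type
  /-- there are finitely many cells -/
  [fintypeCell : Fintype Cell]
  /-- the number of vertices of a cell -/
  sides : Cell → ℕ
  three_le_sides : ∀ c, 3 ≤ sides c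
  /-- the vertices of a cell, in cyclic order -/
  vertex : (c : Cell) → Fin (sides c) → Plane
  vertex_injective : ∀ c, Function.Injective (vertex c)
  /-- the interior point of a cell -/
  center : Cell → Plane
  nondegenerate : ∀ c i,
    AffineIndependent ℝ ![center c, vertex c i, vertex c (finRotate _ i)]
  center_mem_interior : ∀ c, center c ∈ interior
    (⋃ i, convexHull ℝ {center c, vertex c i, vertex c (finRotate _ i)})
  /-- distinct triangles do not overlap -/
  disjoint_interior : ∀ τ τ' : (Σ c, Fin (sides c)), τ ≠ τ' → Disjoint
    (interior (convexHull ℝ {center τ.1, vertex τ.1 τ.2, vertex τ.1 (finRotate _ τ.2)}))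
    (interior (convexHull ℝ {center τ'.1, vertex τ'.1 τ'.2, vertex τ'.1 (finRotate _ τ'.2)}))
  /-- distinct triangles meet in a common vertex, a common edge, or not at all -/
  conforming : ∀ τ τ' : (Σ c, Fin (sides c)), τ ≠ τ' →
    convexHull ℝ {center τ.1, vertex τ.1 τ.2, vertex τ.1 (finRotate _ τ.2)} ∩
      convexHull ℝ {center τ'.1, vertex τ'.1 τ'.2, vertex τ'.1 (finRotate _ τ'.2)} ⊆
    convexHull ℝ (({center τ.1, vertex τ.1 τ.2, vertex τ.1 (finRotate _ τ.2)} : Set Plane) ∩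
      {center τ'.1, vertex τ'.1 τ'.2, vertex τ'.1 (finRotate _ τ'.2)})
  cover : ⋃ τ : (Σ c, Fin (sides c)),
    convexHull ℝ {center τ.1, vertex τ.1 τ.2, vertex τ.1 (finRotate _ τ.2)} = closure Ω

attribute [instance] Mesh.fintypeCell

namespace Mesh

variable {Ω : Set Plane} (M : Mesh Ω)

/-- The triangles of the simplicial submesh: `⟨c, i⟩` is the triangle spanned by the interior
point of the cell `c` and the `i`-th side of `c`. -/
abbrev Tri : Type := Σ c, Fin (M.sides c)

/-- The dual edges: `⟨c, i⟩` joins the interior point of the cell `c` to the `i`-th vertex of `c`. -/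
abbrev DualEdge : Type := Σ c, Fin (M.sides c)

/-- The first endpoint of the primal edge of a triangle. -/
def fst (τ : M.Tri) : Plane := M.vertex τ.1 τ.2

/-- The second endpoint of the primal edge of a triangle. -/
def snd (τ : M.Tri) : Plane := M.vertex τ.1 (finRotate _ τ.2)

/-- A triangle as a closed subset of the plane. -/
def triSet (τ : M.Tri) : Set Plane := convexHull ℝ {M.center τ.1, M.fst τ, M.snd τ}

/-- The set of primal edges: a primal edge is a side of a cell. A side shared by two cells is
one edge. -/
abbrev PrimalEdge : Type :=
  {e : Sym2 Plane // ∃ τ : M.Tri, s(M.fst τ, M.snd τ) = e}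

instance : Finite M.PrimalEdge :=
  (Set.finite_range fun τ : M.Tri => s(M.fst τ, M.snd τ)).to_subtype

instance : Fintype M.PrimalEdge := Fintype.ofFinite _

/-- The primal edge of a triangle. -/
def primalEdge (τ : M.Tri) : M.PrimalEdge := ⟨s(M.fst τ, M.snd τ), τ, rfl⟩

/-- Some triangle that has the given primal edge. It is used to evaluate on the edge those
quantities that take the same value from all sides of the edge. -/
def side (e : M.PrimalEdge) : M.Tri := e.2.choose

/-- A primal edge is interior if it does not lie on the boundary of `Ω`. -/
def IsInteriorEdge (e : M.PrimalEdge) : Prop := ¬ edgeSet e.1 ⊆ frontier Ω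

/-- The segment of a dual edge. -/
def dualSym (e : M.DualEdge) : Sym2 Plane := s(M.center e.1, M.vertex e.1 e.2)

/-- One of the two triangles that share the dual edge `e`. -/
def after (e : M.DualEdge) : M.Tri := e

/-- The other triangle that shares the dual edge `e`. -/
def before (e : M.DualEdge) : M.Tri := ⟨e.1, (finRotate _).symm e.2⟩

/-- The outward unit normal of a triangle on its primal edge. -/
def normalPrimal (τ : M.Tri) : Fin 2 → ℝ := outwardNormal (M.fst τ) (M.snd τ) (M.center τ.1)

/-- The outward unit normal of the triangle `after e` on its edge `e`. -/
def normalAfter (e : M.DualEdge) : Fin 2 → ℝ :=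
  outwardNormal (M.center e.1) (M.vertex e.1 e.2) (M.vertex e.1 (finRotate _ e.2))

/-- The outward unit normal of the triangle `before e` on its edge `e`. -/
def normalBefore (e : M.DualEdge) : Fin 2 → ℝ :=
  outwardNormal (M.center e.1) (M.vertex e.1 e.2) (M.vertex e.1 ((finRotate _).symm e.2))

/-- A choice of a unit normal on every edge, pointing out of `Ω` on the boundary edges. -/
structure EdgeNormals where
  /-- the normals on the primal edges -/
  primal : M.PrimalEdge → Fin 2 → ℝ
  /-- the normals on the dual edges -/
  dual : M.DualEdge → Fin 2 → ℝ
  primal_isUnitNormal : ∀ τ, IsUnitNormal (primal (M.primalEdge τ)) (M.fst τ) (M.snd τ)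
  dual_isUnitNormal : ∀ e, IsUnitNormal (dual e) (M.center e.1) (M.vertex e.1 e.2)
  primal_outward : ∀ τ, ¬ M.IsInteriorEdge (M.primalEdge τ) →
    primal (M.primalEdge τ) = M.normalPrimal τ

/-! ### Piecewise polynomials -/

/-- Scalar piecewise polynomials: one polynomial on each triangle. -/
abbrev ScalarField : Type := M.Tri → Poly

/-- Vector valued piecewise polynomials. -/
abbrev VectorField : Type := M.Tri → Fin 2 → Poly

/-- Matrix valued piecewise polynomials. -/
abbrev TensorField : Type := M.Tri → Matrix (Fin 2) (Fin 2) Poly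

/-- Vector valued piecewise polynomials on the dual edges. On each edge each component is a
polynomial in the affine parameter of the edge. -/
abbrev EdgeField : Type := M.DualEdge → Fin 2 → Polynomial ℝ

end Mesh

/-- The value of a polynomial at a point of the plane. -/
def val (p : Poly) (x : Plane) : ℝ := MvPolynomial.eval x.ofLp p

/-- The value of a vector of polynomials. -/
def vval (v : Fin 2 → Poly) (x : Plane) : Fin 2 → ℝ := fun i => val (v i) x

/-- The value of a matrix of polynomials. -/
def mval (G : Matrix (Fin 2) (Fin 2) Poly) (x : Plane) : Matrix (Fin 2) (Fin 2) ℝ :=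
  Matrix.of fun i j => val (G i j) x

/-- The gradient of a scalar polynomial. -/
def grad (q : Poly) : Fin 2 → Poly := fun j => MvPolynomial.pderiv j q

/-- The gradient of a vector polynomial, `(∇v)_{ij} = ∂_j v_i`. -/
def vgrad (v : Fin 2 → Poly) : Matrix (Fin 2) (Fin 2) Poly :=
  Matrix.of fun i j => MvPolynomial.pderiv j (v i)

/-- The divergence of a vector polynomial. -/
def dvg (v : Fin 2 → Poly) : Poly := ∑ j, MvPolynomial.pderiv j (v j)

/-- The row-wise divergence of a matrix polynomial. -/
def mdvg (G : Matrix (Fin 2) (Fin 2) Poly) : Fin 2 → Poly :=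
  fun i => ∑ j, MvPolynomial.pderiv j (G i j)

/-- The product `A : B = ∑ A_{ij} B_{ij}`. -/
def ddot (A B : Matrix (Fin 2) (Fin 2) ℝ) : ℝ := ∑ i, ∑ j, A i j * B i j

namespace Mesh

variable {Ω : Set Plane} (M : Mesh Ω)

/-- The value of an edge field at a point of the dual edge `e`. -/
def eval (w : M.EdgeField) (e : M.DualEdge) (x : Plane) : Fin 2 → ℝ :=
  fun i => (w e i).eval (edgeParam (M.center e.1) (M.vertex e.1 e.2) x)

/-- The integral over `Ω` of a function that is given triangle by triangle. -/
def integral (φ : M.Tri → Plane → ℝ) : ℝ := ∑ τ, ∫ x in M.triSet τ, φ τ x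

/-- The integral `∑_{e ∈ F_u} ∫_e φ_e ds`. -/
def primalIntegral (φ : M.PrimalEdge → Plane → ℝ) : ℝ := ∑ e, edgeIntegral e.1 (φ e)

/-- The integral `∑_{e ∈ F_p} ∫_e φ_e ds`. -/
def dualIntegral (φ : M.DualEdge → Plane → ℝ) : ℝ := ∑ e, edgeIntegral (M.dualSym e) (φ e)

namespace EdgeNormals

variable {M} (N : M.EdgeNormals)

open Classical in
/-- The jump `∑ δ_i φ_i` on a primal edge, over the (one or two) triangles that have this edge;
`δ_i` is the product of the outward normal of the triangle and the fixed normal of the edge. -/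
def jumpPrimal {V : Type} [AddCommGroup V] [Module ℝ V] (φ : M.Tri → V) (e : M.PrimalEdge) : V :=
  ∑ τ : M.Tri with M.primalEdge τ = e, (M.normalPrimal τ ⬝ᵥ N.primal e) • φ τ

/-- The jump `δ_1 φ_1 + δ_2 φ_2` on a dual edge. -/
def jumpDual {V : Type} [AddCommGroup V] [Module ℝ V] (φ : M.Tri → V) (e : M.DualEdge) : V :=
  (M.normalBefore e ⬝ᵥ N.dual e) • φ (M.before e) + (M.normalAfter e ⬝ᵥ N.dual e) • φ (M.after e)

/-! ### The finite element spaces -/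

/-- The velocity space `U^h`. -/
def velocitySpace (k : ℕ) : Submodule ℝ M.VectorField where
  carrier := {v | (∀ τ i, v τ i ∈ MvPolynomial.restrictTotalDegree (Fin 2) ℝ k) ∧
    ∀ e : M.DualEdge, ∀ x ∈ edgeSet (M.dualSym e),
      vval (v (M.before e)) x ⬝ᵥ N.dual e = vval (v (M.after e)) x ⬝ᵥ N.dual e}
  add_mem' := by
    rintro v w ⟨hv, hv'⟩ ⟨hw, hw'⟩
    refine ⟨fun τ i => Submodule.add_mem _ (hv τ i) (hw τ i), fun e x hx => ?_⟩
    have h1 := hv' e x hx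
    have h2 := hw' e x hx
    simp only [vval, val, dotProduct, Fin.sum_univ_two, Pi.add_apply, map_add] at h1 h2 ⊢
    linear_combination h1 + h2
  zero_mem' := by
    refine ⟨fun τ i => Submodule.zero_mem _, fun e x hx => ?_⟩
    simp [vval, val]
  smul_mem' := by
    rintro a v ⟨hv, hv'⟩
    refine ⟨fun τ i => Submodule.smul_mem _ a (hv τ i), fun e x hx => ?_⟩
    have h1 := hv' e x hx
    simp only [vval, val, dotProduct, Fin.sum_univ_two, Pi.smul_apply,
      MvPolynomial.smul_eval] at h1 ⊢
    linear_combination a * h1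

/-- The velocity gradient space `W^h`. -/
def gradientSpace (k : ℕ) : Submodule ℝ M.TensorField where
  carrier := {G | (∀ τ i j, G τ i j ∈ MvPolynomial.restrictTotalDegree (Fin 2) ℝ k) ∧
    ∀ e : M.PrimalEdge, M.IsInteriorEdge e →
      ∀ τ τ', M.primalEdge τ = e → M.primalEdge τ' = e → ∀ x ∈ edgeSet e.1,
        mval (G τ) x *ᵥ N.primal e = mval (G τ') x *ᵥ N.primal e}
  add_mem' := by
    rintro G H ⟨hG, hG'⟩ ⟨hH, hH'⟩
    refine ⟨fun τ i j => Submodule.add_mem _ (hG τ i j) (hH τ i j),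
      fun e he τ τ' hτ hτ' x hx => ?_⟩
    have h1 := hG' e he τ τ' hτ hτ' x hx
    have h2 := hH' e he τ τ' hτ hτ' x hx
    funext i
    have h1 := congrFun h1 i
    have h2 := congrFun h2 i
    simp only [mval, val, mulVec, dotProduct, Fin.sum_univ_two, Pi.add_apply, Matrix.add_apply,
      Matrix.of_apply, map_add] at h1 h2 ⊢
    linear_combination h1 + h2
  zero_mem' := by
    refine ⟨fun τ i j => Submodule.zero_mem _, fun e he τ τ' hτ hτ' x hx => ?_⟩
    simp [mval, val]
  smul_mem' := by
    rintro a G ⟨hG, hG'⟩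
    refine ⟨fun τ i j => Submodule.smul_mem _ a (hG τ i j), fun e he τ τ' hτ hτ' x hx => ?_⟩
    have h1 := hG' e he τ τ' hτ hτ' x hx
    funext i
    have h1 := congrFun h1 i
    simp only [mval, val, mulVec, dotProduct, Fin.sum_univ_two, Pi.smul_apply, Matrix.smul_apply,
      Matrix.of_apply, MvPolynomial.smul_eval] at h1 ⊢
    linear_combination a * h1

/-- The space `Û^h` of tangential vector fields on the dual edges. -/
def traceSpace (k : ℕ) : Submodule ℝ M.EdgeField where
  carrier := {w | (∀ e i, w e i ∈ Polynomial.degreeLE ℝ k) ∧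
    ∀ e : M.DualEdge, ∀ x ∈ edgeSet (M.dualSym e), M.eval w e x ⬝ᵥ N.dual e = 0}
  add_mem' := by
    rintro v w ⟨hv, hv'⟩ ⟨hw, hw'⟩
    refine ⟨fun e i => Submodule.add_mem _ (hv e i) (hw e i), fun e x hx => ?_⟩
    have h1 := hv' e x hx
    have h2 := hw' e x hx
    simp only [Mesh.eval, dotProduct, Fin.sum_univ_two, Pi.add_apply,
      Polynomial.eval_add] at h1 h2 ⊢
    linear_combination h1 + h2
  zero_mem' := by
    refine ⟨fun e i => Submodule.zero_mem _, fun e x hx => ?_⟩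
    simp [Mesh.eval, dotProduct]
  smul_mem' := by
    rintro a v ⟨hv, hv'⟩
    refine ⟨fun e i => Submodule.smul_mem _ a (hv e i), fun e x hx => ?_⟩
    have h1 := hv' e x hx
    simp only [Mesh.eval, dotProduct, Fin.sum_univ_two, Pi.smul_apply,
      Polynomial.eval_smul, smul_eq_mul] at h1 ⊢
    linear_combination a * h1

end EdgeNormals

theorem integrableOn_val (p : Poly) (τ : M.Tri) :
    IntegrableOn (fun x => val p x) (M.triSet τ) := by
  have hc : Continuous fun x : Plane => val p x :=
    (MvPolynomial.continuous_eval p).comp (PiLp.continuous_ofLp 2 _)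
  have hK : IsCompact (M.triSet τ) :=
    (Set.toFinite {M.center τ.1, M.fst τ, M.snd τ}).isCompact_convexHull (𝕜 := ℝ)
  exact hc.continuousOn.integrableOn_compact hK

/-- The pressure space `P^h`. -/
def pressureSpace (k : ℕ) : Submodule ℝ M.ScalarField where
  carrier := {q | (∀ τ, q τ ∈ MvPolynomial.restrictTotalDegree (Fin 2) ℝ k) ∧
    (∀ e : M.PrimalEdge, M.IsInteriorEdge e →
      ∀ τ τ', M.primalEdge τ = e → M.primalEdge τ' = e → ∀ x ∈ edgeSet e.1,
        val (q τ) x = val (q τ') x) ∧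
    M.integral (fun τ x => val (q τ) x) = 0}
  add_mem' := by
    rintro q r ⟨hq, hq', hq''⟩ ⟨hr, hr', hr''⟩
    refine ⟨fun τ => Submodule.add_mem _ (hq τ) (hr τ), fun e he τ τ' hτ hτ' x hx => ?_, ?_⟩
    · have h1 := hq' e he τ τ' hτ hτ' x hx
      have h2 := hr' e he τ τ' hτ hτ' x hx
      simp only [val, Pi.add_apply, map_add] at h1 h2 ⊢
      rw [h1, h2]
    · have h : M.integral (fun τ x => val ((q + r) τ) x) =
          M.integral (fun τ x => val (q τ) x) + M.integral (fun τ x => val (r τ) x) := by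
        unfold integral
        rw [← Finset.sum_add_distrib]
        refine Finset.sum_congr rfl fun τ _ => ?_
        rw [← integral_add (M.integrableOn_val _ τ) (M.integrableOn_val _ τ)]
        simp [val]
      rw [h, hq'', hr'', add_zero]
  zero_mem' := by
    refine ⟨fun τ => Submodule.zero_mem _, fun e he τ τ' hτ hτ' x hx => ?_, ?_⟩
    · simp [val]
    · simp [integral, val]
  smul_mem' := by
    rintro a q ⟨hq, hq', hq''⟩
    refine ⟨fun τ => Submodule.smul_mem _ a (hq τ), fun e he τ τ' hτ hτ' x hx => ?_, ?_⟩
    · have h1 := hq' e he τ τ' hτ hτ' x hx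
      simp only [val, Pi.smul_apply, MvPolynomial.smul_eval] at h1 ⊢
      rw [h1]
    · have h : M.integral (fun τ x => val ((a • q) τ) x) =
          a * M.integral (fun τ x => val (q τ) x) := by
        unfold integral
        rw [Finset.mul_sum]
        refine Finset.sum_congr rfl fun τ _ => ?_
        rw [← integral_const_mul]
        simp [val]
      rw [h, hq'', mul_zero]

namespace EdgeNormals

variable {M} (N : M.EdgeNormals)

/-! ### The bilinear forms -/

/-- `B_h^*(v, G) = -∫ v · div_h G + ∑_{F_p} ∫_e (v · n) n · [G n]`. -/
def formBstar (v : M.VectorField) (G : M.TensorField) : ℝ :=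
  -M.integral (fun τ x => vval (v τ) x ⬝ᵥ vval (mdvg (G τ)) x) +
    M.dualIntegral (fun e x => (vval (v (M.after e)) x ⬝ᵥ N.dual e) *
      (N.dual e ⬝ᵥ N.jumpDual (fun τ => mval (G τ) x *ᵥ N.dual e) e))

/-- `B_h(G, v) = ∫ G : ∇_h v - ∑_{F_u} ∫_e [v] · (G n) - ∑_{F_p} ∫_e [(v · t) t · (G n)]`. -/
def formB (G : M.TensorField) (v : M.VectorField) : ℝ :=
  M.integral (fun τ x => ddot (mval (G τ) x) (mval (vgrad (v τ)) x)) -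
    M.primalIntegral (fun e x => N.jumpPrimal (fun τ => vval (v τ) x) e ⬝ᵥ
      (mval (G (M.side e)) x *ᵥ N.primal e)) -
    M.dualIntegral (fun e x => N.jumpDual (fun τ => (vval (v τ) x ⬝ᵥ tangent (N.dual e)) *
      (tangent (N.dual e) ⬝ᵥ (mval (G τ) x *ᵥ N.dual e))) e)

/-- `T_h^*(w, G) = ∑_{F_p} ∫_e w · [G n]`. -/
def formTstar (w : M.EdgeField) (G : M.TensorField) : ℝ :=
  M.dualIntegral (fun e x =>
    M.eval w e x ⬝ᵥ N.jumpDual (fun τ => mval (G τ) x *ᵥ N.dual e) e)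

/-- `T_h(G, w) = ∑_{F_p} ∫_e [G n] · w`. -/
def formT (G : M.TensorField) (w : M.EdgeField) : ℝ :=
  M.dualIntegral (fun e x =>
    N.jumpDual (fun τ => mval (G τ) x *ᵥ N.dual e) e ⬝ᵥ M.eval w e x)

/-- `b_h^*(q, v) = -∫ q div_h v + ∑_{F_u} ∫_e q [v · n]`. -/
def formbstar (q : M.ScalarField) (v : M.VectorField) : ℝ :=
  -M.integral (fun τ x => val (q τ) x * val (dvg (v τ)) x) +
    M.primalIntegral (fun e x => val (q (M.side e)) x *
      N.jumpPrimal (fun τ => vval (v τ) x ⬝ᵥ N.primal e) e)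

/-- `b_h(v, q) = ∫ v · ∇_h q - ∑_{F_p} ∫_e (v · n) [q]`. -/
def formb (v : M.VectorField) (q : M.ScalarField) : ℝ :=
  M.integral (fun τ x => vval (v τ) x ⬝ᵥ vval (grad (q τ)) x) -
    M.dualIntegral (fun e x => (vval (v (M.after e)) x ⬝ᵥ N.dual e) *
      N.jumpDual (fun τ => val (q τ) x) e)

/-- The discrete system for `(L, u, w, p) ∈ W^h × U^h × Û^h × P^h`. -/
structure IsSolution (k : ℕ) (ε : ℝ) (α : Plane → ℝ) (f : Plane → Fin 2 → ℝ) (g : Plane → ℝ)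
    (L : N.gradientSpace k) (u : N.velocitySpace k) (w : N.traceSpace k)
    (p : M.pressureSpace k) : Prop where
  eq_gradient : ∀ G : N.gradientSpace k,
    M.integral (fun τ x => ddot (mval (L.1 τ) x) (mval (G.1 τ) x)) =
      √ε * N.formBstar u G + √ε * N.formTstar w G
  eq_momentum : ∀ v : N.velocitySpace k,
    √ε * N.formB L v + M.integral (fun τ x => (α x • vval (u.1 τ) x) ⬝ᵥ vval (v.1 τ) x) +
      N.formbstar p v = M.integral (fun τ x => f x ⬝ᵥ vval (v.1 τ) x)
  eq_mass : ∀ q : M.pressureSpace k,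
    -N.formb u q = M.integral (fun τ x => g x * val (q.1 τ) x)
  eq_trace : ∀ z : N.traceSpace k, N.formT L z = 0

end EdgeNormals

end Mesh

end SDG

end

noncomputable section

namespace SDG

/-! ### Triangles in the plane -/

/-! Summing the four equations turns the system into one equation `systemForm s = systemLoad` in the
dual of the product space. That space is finite-dimensional and has the dimension of its dual, so it
suffices that `systemForm` has trivial kernel.

The kernel is handled by an energy argument. The divergence theorem on each triangle, summed over
the mesh, gives `formB_eq_formBstar` and `formbstar_eq_formb`: on the discrete spaces `B_h` is
adjoint to `B_h^*` and `b_h` to `b_h^*`. Testing a kernel element with itself makes the `B` and `b`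
terms cancel; the trace equation removes the term with `T_h`. What is left is `(L, L) + (α u, u) =
0`, hence `L = 0` and `u = 0`.

There remain two injectivity statements, each proved by an explicit test function that produces a
sum of squares.

Pressure (`pressure_eq_zero_of_formb`): the normals of the two dual edges of a triangle are
independent, so a velocity is determined there by its two normal components. Let each be a
barycentric coordinate that vanishes on the edge concerned, times a derivative of `q`; then the edge
terms of `b_h` drop out and the volume term is a weighted sum of squares, so `q` is constant on each
triangle. A velocity whose normal component on each dual edge is the jump of `q` then shows that
these jumps vanish. Functions in `P^h` do not jump over interior primal edges, and `Ω` stays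
connected without the finitely many vertices, so `q` is one constant, which is zero because its mean
is.

Trace (`trace_eq_zero_of_formTstar`): take `G = φ n' ⊗ t` on each triangle, with `t` along the
primal edge and `n'` the normal of the second dual edge. It has no flux through the primal edge, and
on the second dual edge its flux is orthogonal to the tangential field `w`. With `φ` proportional to
`w · n'`, the first dual edge contributes a square. So `w` is orthogonal to two independent normals
and vanishes. -/

/-- Twice the signed area of the triangle `a b c`. -/
def tdet (a b c : Plane) : ℝ :=
  (b 0 - a 0) * (c 1 - a 1) - (b 1 - a 1) * (c 0 - a 0)

theorem tdet_swap (a b c : Plane) : tdet a c b = -tdet a b c := by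
  unfold tdet; ring

theorem tdet_rotate (a b c : Plane) : tdet b c a = tdet a b c := by
  unfold tdet; ring

theorem plane_ext {x y : Plane} (h0 : x 0 = y 0) (h1 : x 1 = y 1) : x = y := by
  ext i; fin_cases i <;> assumption

/-- The point with affine coordinates `s`, `t` in the frame of the triangle `a b c`. -/
def triPoint (a b c : Plane) (s t : ℝ) : Plane := a + s • (b - a) + t • (c - a)

theorem triPoint_apply (a b c : Plane) (s t : ℝ) (i : Fin 2) :
    triPoint a b c s t i = a i + s * (b i - a i) + t * (c i - a i) := by
  simp [triPoint]

theorem tdet_ne_zero {a b c : Plane} (h : AffineIndependent ℝ ![a, b, c]) :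
    tdet a b c ≠ 0 := by
  intro h0
  rw [affineIndependent_iff_linearIndependent_vsub ℝ _ (0 : Fin 3)] at h
  have hb : b - a ≠ 0 := by
    have := h.ne_zero (i := ⟨1, by decide⟩)
    simpa using this
  have hc : ∀ s : ℝ × ℝ, s.1 • (b - a) + s.2 • (c - a) = 0 → s = 0 := by
    intro s hs
    have := linearIndependent_iff'.1 h Finset.univ
      (fun i => if i.1 = 1 then s.1 else s.2) (by
        rw [← hs]
        have : (Finset.univ : Finset {x : Fin 3 // x ≠ 0}) =
          {⟨1, by decide⟩, ⟨2, by decide⟩} := by decide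
        rw [this, Finset.sum_pair (by decide)]
        simp)
    have h1 := this ⟨1, by decide⟩ (Finset.mem_univ _)
    have h2 := this ⟨2, by decide⟩ (Finset.mem_univ _)
    simp at h1 h2
    exact Prod.ext h1 h2
  unfold tdet at h0
  -- When the determinant vanishes, the coordinates of the two side vectors are themselves the
  -- coefficients of a linear relation between these vectors.
  have e0 := hc (c 0 - a 0, -(b 0 - a 0)) (by
    apply plane_ext <;> simp <;> linarith)
  have e1 := hc (c 1 - a 1, -(b 1 - a 1)) (by
    apply plane_ext <;> simp <;> linarith)
  simp only [Prod.mk_eq_zero, neg_eq_zero] at e0 e1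
  apply hb
  apply plane_ext <;> simp [e0.2, e1.2]

/-- Cramer's rule in the frame `b - a`, `c - a`. -/
theorem triPoint_coords {a b c : Plane} (h : tdet a b c ≠ 0) (x : Plane) :
    x = triPoint a b c (tdet a x c / tdet a b c) (tdet a b x / tdet a b c) := by
  apply plane_ext <;> rw [triPoint_apply] <;> field_simp <;> unfold tdet <;> ring

theorem tdet_triPoint_left (a b c : Plane) (s t : ℝ) :
    tdet a (triPoint a b c s t) c = s * tdet a b c := by
  simp only [tdet, triPoint_apply]; ring

theorem tdet_triPoint_right (a b c : Plane) (s t : ℝ) :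
    tdet a b (triPoint a b c s t) = t * tdet a b c := by
  simp only [tdet, triPoint_apply]; ring

theorem mem_convexHull_triple {a b c x : Plane} :
    x ∈ convexHull ℝ ({a, b, c} : Set Plane) ↔
      ∃ s t : ℝ, 0 ≤ s ∧ 0 ≤ t ∧ s + t ≤ 1 ∧ x = triPoint a b c s t := by
  rw [convexHull_insert (by simp), convexHull_pair]
  simp only [convexJoin_singleton_left, Set.mem_iUnion, segment_eq_image_lineMap, Set.mem_image,
    Set.mem_Icc, exists_prop]
  constructor
  · rintro ⟨_, ⟨r, hr, rfl⟩, q, hq, rfl⟩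
    refine ⟨q * (1 - r), q * r, by nlinarith, by nlinarith, by nlinarith, ?_⟩
    simp only [AffineMap.lineMap_apply, triPoint, vsub_eq_sub, vadd_eq_add]
    module
  · rintro ⟨s, t, hs, ht, hst, rfl⟩
    by_cases h : s + t = 0
    · obtain rfl : s = 0 := by linarith
      obtain rfl : t = 0 := by linarith
      exact ⟨_, ⟨0, by simp, rfl⟩, 0, by simp, by simp [triPoint]⟩
    · have hp : 0 < s + t := lt_of_le_of_ne (by linarith) (Ne.symm h)
      refine ⟨_, ⟨t / (s + t), ⟨by positivity, by rw [div_le_one hp]; linarith⟩, rfl⟩, s + t,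
        ⟨hp.le, hst⟩, ?_⟩
      simp only [AffineMap.lineMap_apply, triPoint, vsub_eq_sub, vadd_eq_add]
      have : s • (b - a) + t • (c - a) = (s + t) • (b - a) + t • (c - b) := by module
      rw [add_assoc, this]
      have h2 : (s + t) * (t / (s + t)) = t := by field_simp
      rw [show (s + t) • ((t / (s + t)) • (c - b) + b - a) =
        ((s + t) * (t / (s + t))) • (c - b) + (s + t) • (b - a) by module, h2]
      abel

theorem continuous_tdet_left (a c : Plane) : Continuous fun x => tdet a x c := by
  unfold tdet; fun_prop

theorem continuous_tdet_right (a b : Plane) : Continuous fun x => tdet a b x := by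
  unfold tdet; fun_prop

/-- The points of the open triangle `a b c`. -/
def openTri (a b c : Plane) : Set Plane :=
  {x | 0 < tdet a x c / tdet a b c ∧ 0 < tdet a b x / tdet a b c ∧
    tdet a x c / tdet a b c + tdet a b x / tdet a b c < 1}

theorem isOpen_openTri (a b c : Plane) : IsOpen (openTri a b c) := by
  have c1 := (continuous_tdet_left a c).div_const (tdet a b c)
  have c2 := (continuous_tdet_right a b).div_const (tdet a b c)
  exact (isOpen_lt continuous_const c1).inter
    ((isOpen_lt continuous_const c2).inter (isOpen_lt (c1.add c2) continuous_const))

theorem openTri_subset_interior {a b c : Plane} (h : tdet a b c ≠ 0) :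
    openTri a b c ⊆ interior (convexHull ℝ ({a, b, c} : Set Plane)) := by
  refine interior_maximal ?_ (isOpen_openTri a b c)
  rintro x ⟨h1, h2, h3⟩
  exact mem_convexHull_triple.2 ⟨_, _, h1.le, h2.le, h3.le, triPoint_coords h x⟩

theorem triPoint_mem_interior {a b c : Plane} (h : tdet a b c ≠ 0) {s t : ℝ} (hs : 0 < s)
    (ht : 0 < t) (hst : s + t < 1) :
    triPoint a b c s t ∈ interior (convexHull ℝ ({a, b, c} : Set Plane)) := by
  apply openTri_subset_interior h
  simp only [openTri, Set.mem_ofPred_eq, tdet_triPoint_left, tdet_triPoint_right]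
  rw [mul_div_cancel_right₀ _ h, mul_div_cancel_right₀ _ h]
  exact ⟨hs, ht, hst⟩

theorem interior_triangle_nonempty {a b c : Plane} (h : tdet a b c ≠ 0) :
    (interior (convexHull ℝ ({a, b, c} : Set Plane))).Nonempty :=
  ⟨_, triPoint_mem_interior h (s := 1 / 3) (t := 1 / 3) (by norm_num) (by norm_num) (by norm_num)⟩

theorem triangle_subset_closure_interior {a b c : Plane} (h : tdet a b c ≠ 0) :
    convexHull ℝ ({a, b, c} : Set Plane) ⊆
      closure (interior (convexHull ℝ ({a, b, c} : Set Plane))) := by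
  rw [(convex_convexHull ℝ _).closure_interior_eq_closure_of_nonempty_interior
    (interior_triangle_nonempty h)]
  exact subset_closure

/-- Two triangles with a common edge, both on the same side of it, overlap. -/
theorem not_disjoint_interior_of_same_side {a b c c' : Plane} (h : 0 < tdet a b c * tdet a b c') :
    ¬ Disjoint (interior (convexHull ℝ ({a, b, c} : Set Plane)))
      (interior (convexHull ℝ ({a, b, c'} : Set Plane))) := by
  have h1 : tdet a b c ≠ 0 := fun h0 => by simp [h0] at h
  have h2 : tdet a b c' ≠ 0 := fun h0 => by simp [h0] at h
  set p := tdet a c c' / tdet a b c' with hp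
  set q := tdet a b c / tdet a b c' with hq
  have hq0 : 0 < q := by
    rw [hq, ← mul_div_mul_right _ _ h2]
    exact div_pos h (mul_self_pos.2 h2)
  have hcc : c = triPoint a b c' p q := triPoint_coords h2 c
  -- A point just above the midpoint of the common edge lies in both open triangles. Its coordinates
  -- are `(1/2, δ)` in one frame and `(1/2 + δ p, δ q)` in the other; this `δ` gives `δ (|p| + |q|)
  -- < 1/4`, and `q > 0` says that the triangles lie on the same side.
  set δ : ℝ := 1 / (4 * (1 + |p| + |q|)) with hδ
  have hden : 0 < 4 * (1 + |p| + |q|) := by positivity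
  have hδ0 : 0 < δ := by positivity
  have hδ1 : δ * (4 * (1 + |p| + |q|)) = 1 := by rw [hδ]; field_simp
  have hpabs := mul_le_mul_of_nonneg_left (neg_abs_le p) hδ0.le
  have hpabs' := mul_le_mul_of_nonneg_left (le_abs_self p) hδ0.le
  have hqabs := mul_le_mul_of_nonneg_left (le_abs_self q) hδ0.le
  have hq1 := mul_nonneg hδ0.le (abs_nonneg q)
  have hp1 := mul_nonneg hδ0.le (abs_nonneg p)
  rw [Set.not_disjoint_iff]
  refine ⟨triPoint a b c (1 / 2) δ, triPoint_mem_interior h1 (by norm_num) hδ0 (by nlinarith), ?_⟩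
  have : triPoint a b c (1 / 2) δ = triPoint a b c' (1 / 2 + δ * p) (δ * q) := by
    apply plane_ext <;>
    · simp only [triPoint_apply]
      rw [hcc, triPoint_apply]; ring
  rw [this]
  exact triPoint_mem_interior h2 (by nlinarith) (by positivity) (by nlinarith)

/-! ### Outward normals -/

theorem ne_of_tdet_ne_zero {a b c : Plane} (h : tdet a b c ≠ 0) : a ≠ b := by
  rintro rfl; simp [tdet] at h

/-- The orientation, `1` or `-1`, of a nondegenerate triangle. -/
def orient (a b c : Plane) : ℝ := if 0 < tdet a b c then 1 else -1

theorem orient_mul_tdet (a b c : Plane) : orient a b c * tdet a b c = |tdet a b c| := by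
  unfold orient
  split_ifs with h
  · rw [abs_of_pos h, one_mul]
  · rw [abs_of_nonpos (not_lt.1 h), neg_one_mul]

theorem orient_mul_self (a b c : Plane) : orient a b c * orient a b c = 1 := by
  unfold orient; split_ifs <;> norm_num

theorem orient_swap {a b c : Plane} (h : tdet a b c ≠ 0) : orient a c b = -orient a b c := by
  unfold orient
  rw [tdet_swap]
  rcases lt_or_gt_of_ne h with h | h
  · rw [if_pos (by linarith), if_neg (by linarith)]; norm_num
  · rw [if_neg (by linarith), if_pos (by linarith)]

theorem orient_rotate (a b c : Plane) : orient b c a = orient a b c := by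
  unfold orient; rw [tdet_rotate]

/-- The rotated edge vector has scalar product `-tdet a b c` with `c - a`, so the case distinction
in `outwardNormal` is one on the orientation. -/
theorem outwardNormal_eq (a b c : Plane) :
    outwardNormal a b c =
      (orient a b c * (dist a b)⁻¹) • ![b 1 - a 1, -(b 0 - a 0)] := by
  by_cases hab : a = b
  · subst hab; simp [outwardNormal]
  have hd : 0 < (dist a b)⁻¹ := inv_pos.2 (dist_pos.2 hab)
  have key : ((dist a b)⁻¹ • ![(b - a) 1, -((b - a) 0)] : Fin 2 → ℝ) ⬝ᵥ (c - a).ofLp =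
      -((dist a b)⁻¹ * tdet a b c) := by
    simp [dotProduct, Fin.sum_univ_two, tdet]; ring
  unfold outwardNormal orient
  simp only [key, neg_lt_zero, mul_pos_iff_of_pos_left hd]
  split_ifs <;> simp

/-- Multiplication by the length of the edge clears the denominator, so that later identities for
normals are polynomial. -/
theorem dist_mul_outwardNormal_zero {a b : Plane} (h : a ≠ b) (c : Plane) :
    dist a b * outwardNormal a b c 0 = orient a b c * (b 1 - a 1) := by
  have hd : dist a b ≠ 0 := dist_ne_zero.2 h
  rw [outwardNormal_eq]; simp; field_simp

theorem dist_mul_outwardNormal_one {a b : Plane} (h : a ≠ b) (c : Plane) :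
    dist a b * outwardNormal a b c 1 = -(orient a b c * (b 0 - a 0)) := by
  have hd : dist a b ≠ 0 := dist_ne_zero.2 h
  rw [outwardNormal_eq]; simp; field_simp; ring

theorem dist_sq (a b : Plane) : dist a b ^ 2 = (b 0 - a 0) ^ 2 + (b 1 - a 1) ^ 2 := by
  rw [EuclideanSpace.dist_eq, Real.sq_sqrt (by positivity)]
  simp [Fin.sum_univ_two, Real.dist_eq, sq_abs]; ring

theorem isUnitNormal_outwardNormal {a b : Plane} (h : a ≠ b) (c : Plane) :
    IsUnitNormal (outwardNormal a b c) a b := by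
  have hd : dist a b ≠ 0 := dist_ne_zero.2 h
  have h0 := dist_mul_outwardNormal_zero h c
  have h1 := dist_mul_outwardNormal_one h c
  have ho := orient_mul_self a b c
  have hs := dist_sq a b
  simp only [IsUnitNormal, dotProduct, Fin.sum_univ_two]
  constructor
  · have : dist a b ^ 2 * (outwardNormal a b c 0 * outwardNormal a b c 0 +
      outwardNormal a b c 1 * outwardNormal a b c 1) = dist a b ^ 2 * 1 := by
      calc _ = (dist a b * outwardNormal a b c 0) ^ 2 + (dist a b * outwardNormal a b c 1) ^ 2 := by
            ring
        _ = _ := by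
            rw [h0, h1, hs]; linear_combination ((b 0 - a 0) ^ 2 + (b 1 - a 1) ^ 2) * ho
    exact mul_left_cancel₀ (pow_ne_zero 2 hd) this
  · apply mul_left_cancel₀ hd
    simp only [PiLp.sub_apply]
    linear_combination (b 0 - a 0) * h0 + (b 1 - a 1) * h1

/-- Two vectors orthogonal to the same nonzero vector of the plane are parallel; since `n` is a unit
vector, the factor is the scalar product. -/
theorem IsUnitNormal.eq_smul {m n : Fin 2 → ℝ} {a b : Plane} (hab : a ≠ b)
    (hm : IsUnitNormal m a b) (hn : IsUnitNormal n a b) : m = (m ⬝ᵥ n) • n := by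
  obtain ⟨hm1, hm2⟩ := hm
  obtain ⟨hn1, hn2⟩ := hn
  simp only [dotProduct, Fin.sum_univ_two] at hm1 hm2 hn1 hn2 ⊢
  have hd : (m 0 * n 1 - m 1 * n 0) = 0 := by
    by_contra hne
    apply hab
    apply plane_ext
    · apply mul_left_cancel₀ hne
      simp at hm2 hn2
      linear_combination m 1 * hn2 - n 1 * hm2
    · apply mul_left_cancel₀ hne
      simp at hm2 hn2
      linear_combination n 0 * hm2 - m 0 * hn2
  funext i
  fin_cases i <;> simp
  · linear_combination (-(m 0)) * hn1 + n 1 * hd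
  · linear_combination (-(m 1)) * hn1 - n 0 * hd

theorem IsUnitNormal.dotProduct_sq {m n : Fin 2 → ℝ} {a b : Plane} (hab : a ≠ b)
    (hm : IsUnitNormal m a b) (hn : IsUnitNormal n a b) : (m ⬝ᵥ n) * (m ⬝ᵥ n) = 1 := by
  have h := hm.eq_smul hab hn
  have h1 := hm.1
  have h2 := hn.1
  rw [h] at h1
  simp only [smul_dotProduct, dotProduct_smul, h2, smul_eq_mul, mul_one] at h1
  exact h1

theorem outwardNormal_symm {a b c : Plane} (h : tdet a b c ≠ 0) :
    outwardNormal b a c = outwardNormal a b c := by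
  have h' : orient b a c = -orient a b c := by
    rw [← orient_rotate b a c, orient_swap h]
  rw [outwardNormal_eq, outwardNormal_eq, h', dist_comm]
  funext i; fin_cases i <;> simp <;> ring

/-! ### The divergence theorem on a triangle -/

theorem continuous_val (p : Poly) : Continuous fun x => val p x :=
  (MvPolynomial.continuous_eval p).comp (PiLp.continuous_ofLp 2 _)

theorem hasDerivAt_val_line (p : Poly) (x d : Plane) (s : ℝ) :
    HasDerivAt (fun s : ℝ => val p (x + s • d))
      (∑ j, d j * val (MvPolynomial.pderiv j p) (x + s • d)) s := by
  induction p using MvPolynomial.induction_on with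
  | C a => simpa [val] using hasDerivAt_const s a
  | add p q hp hq =>
    have := hp.add hq
    convert! this using 1
    · funext s; simp [val]
    · simp [val, mul_add, Finset.sum_add_distrib]
  | mul_X p i hp =>
    have h1 : HasDerivAt (fun s : ℝ => val (MvPolynomial.X i) (x + s • d)) (d i) s := by
      simp only [val, MvPolynomial.eval_X, PiLp.add_apply, PiLp.smul_apply, smul_eq_mul]
      simpa using ((hasDerivAt_id s).mul_const (d i)).const_add (x i)
    have := hp.mul h1
    convert! this using 1
    · funext s; simp [val]
    · simp only [val, Derivation.leibniz, smul_eq_mul, map_add, map_mul, MvPolynomial.pderiv_X,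
        Fin.sum_univ_two]
      fin_cases i <;> simp <;> ring

theorem triangle_eq_image (a b c : Plane) :
    convexHull ℝ ({a, b, c} : Set Plane) =
      (fun y : ℝ × ℝ => triPoint a b c y.1 y.2) '' {y | 0 ≤ y.1 ∧ 0 ≤ y.2 ∧ y.1 + y.2 ≤ 1} := by
  ext x
  rw [mem_convexHull_triple]
  constructor
  · rintro ⟨s, t, h1, h2, h3, rfl⟩
    exact ⟨(s, t), ⟨h1, h2, h3⟩, rfl⟩
  · rintro ⟨⟨s, t⟩, ⟨h1, h2, h3⟩, rfl⟩
    exact ⟨s, t, h1, h2, h3, rfl⟩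

/-- Fubini with `s` innermost, because the fundamental theorem of calculus will be applied in the
direction `b - a`. -/
theorem integral_reference_triangle {h : ℝ → ℝ → ℝ} (hh : Continuous fun y : ℝ × ℝ => h y.1 y.2) :
    ∫ y in {y : ℝ × ℝ | 0 ≤ y.1 ∧ 0 ≤ y.2 ∧ y.1 + y.2 ≤ 1}, h y.1 y.2 =
      ∫ t in (0 : ℝ)..1, ∫ s in (0 : ℝ)..(1 - t), h s t := by
  set R : Set (ℝ × ℝ) := {y : ℝ × ℝ | 0 ≤ y.1 ∧ 0 ≤ y.2 ∧ y.1 + y.2 ≤ 1} with hR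
  have hcl : IsClosed R := by
    refine (isClosed_le continuous_const continuous_fst).inter
      ((isClosed_le continuous_const continuous_snd).inter
        (isClosed_le (continuous_fst.add continuous_snd) continuous_const))
  have hcpt : IsCompact R := by
    refine (isCompact_Icc (a := ((0 : ℝ), (0 : ℝ))) (b := (1, 1))).of_isClosed_subset hcl ?_
    rintro ⟨s, t⟩ ⟨h1, h2, h3⟩
    simp only at h1 h2 h3
    exact ⟨⟨h1, h2⟩, ⟨by simp only; linarith, by simp only; linarith⟩⟩
  have hint : IntegrableOn (fun y : ℝ × ℝ => h y.1 y.2) R :=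
    hh.continuousOn.integrableOn_compact hcpt
  rw [← integral_indicator hcl.measurableSet, Measure.volume_eq_prod,
    integral_prod_symm _ ((integrable_indicator_iff hcl.measurableSet).2 hint),
    intervalIntegral.integral_of_le zero_le_one, ← integral_Icc_eq_integral_Ioc,
    ← integral_indicator measurableSet_Icc]
  congr 1
  funext t
  by_cases ht : t ∈ Set.Icc (0 : ℝ) 1
  · rw [Set.indicator_of_mem ht, intervalIntegral.integral_of_le (by linarith [ht.2]),
      ← integral_Icc_eq_integral_Ioc, ← integral_indicator measurableSet_Icc]
    congr 1
    funext s
    by_cases hs : s ∈ Set.Icc 0 (1 - t)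
    · rw [Set.indicator_of_mem hs, Set.indicator_of_mem]
      exact ⟨hs.1, ht.1, by simp only; linarith [hs.2]⟩
    · rw [Set.indicator_of_notMem hs, Set.indicator_of_notMem]
      rintro ⟨h1, h2, h3⟩
      exact hs ⟨h1, by simp only at h3; linarith⟩
  · rw [Set.indicator_of_notMem ht]
    rw [← integral_zero ℝ ℝ (μ := volume)]
    congr 1
    funext s
    rw [Set.indicator_of_notMem]
    rintro ⟨h1, h2, h3⟩
    simp only at h1 h2 h3
    exact ht ⟨h2, by linarith⟩

theorem integral_triangle {a b c : Plane} (hd : tdet a b c ≠ 0) {h : Plane → ℝ}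
    (hh : Continuous h) :
    ∫ x in convexHull ℝ ({a, b, c} : Set Plane), h x =
      |tdet a b c| * ∫ t in (0 : ℝ)..1, ∫ s in (0 : ℝ)..(1 - t), h (triPoint a b c s t) := by
  have hcont : Continuous fun y : ℝ × ℝ => triPoint a b c y.1 y.2 := by
    unfold triPoint; fun_prop
  rw [← integral_reference_triangle (h := fun s t => h (triPoint a b c s t)) (hh.comp hcont)]
  set R : Set (ℝ × ℝ) := {y : ℝ × ℝ | 0 ≤ y.1 ∧ 0 ≤ y.2 ∧ y.1 + y.2 ≤ 1} with hR
  have hcl : IsClosed R := by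
    refine (isClosed_le continuous_const continuous_fst).inter
      ((isClosed_le continuous_const continuous_snd).inter
        (isClosed_le (continuous_fst.add continuous_snd) continuous_const))
  -- Both integrals are moved to `Fin 2 → ℝ` by volume preserving maps; there the change of
  -- variables is affine with linear part `A`, whose columns are `b - a` and `c - a`.
  have e1 := (PiLp.volume_preserving_toLp (Fin 2)).setIntegral_preimage_emb
    (MeasurableEquiv.toLp 2 (Fin 2 → ℝ)).measurableEmbedding h
    (convexHull ℝ ({a, b, c} : Set Plane))
  have e2 := (volume_preserving_finTwoArrow ℝ).setIntegral_preimage_emb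
    MeasurableEquiv.finTwoArrow.measurableEmbedding (fun y => h (triPoint a b c y.1 y.2)) R
  rw [← e1, ← e2]
  set Q : Set (Fin 2 → ℝ) := MeasurableEquiv.finTwoArrow ⁻¹' R
  have hQ : MeasurableSet Q := MeasurableEquiv.finTwoArrow.measurable hcl.measurableSet
  set A : Matrix (Fin 2) (Fin 2) ℝ := !![b 0 - a 0, c 0 - a 0; b 1 - a 1, c 1 - a 1]
  have hdet : A.det = tdet a b c := by
    simp only [A, Matrix.det_fin_two_of, tdet]; ring
  let A' : (Fin 2 → ℝ) →L[ℝ] (Fin 2 → ℝ) := LinearMap.toContinuousLinearMap (Matrix.toLin' A)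
  have hA' : ∀ y : Fin 2 → ℝ, WithLp.toLp 2 (a.ofLp + A' y) = triPoint a b c (y 0) (y 1) := by
    intro y
    apply plane_ext <;> simp [A', A, triPoint_apply, dotProduct, Fin.sum_univ_two] <;> ring
  have himg : (WithLp.toLp 2 ⁻¹' convexHull ℝ ({a, b, c} : Set Plane)) =
      (fun y => a.ofLp + A' y) '' Q := by
    ext z
    rw [Set.mem_preimage, triangle_eq_image]
    constructor
    · rintro ⟨⟨s, t⟩, hst, hz⟩
      refine ⟨![s, t], hst, ?_⟩
      have := hA' ![s, t]
      apply WithLp.toLp_injective 2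
      simp only [this]
      simpa using hz
    · rintro ⟨y, hy, rfl⟩
      exact ⟨(y 0, y 1), hy, (hA' y).symm⟩
  rw [himg, integral_image_eq_integral_abs_det_fderiv_smul volume hQ (f' := fun _ => A')
    (fun x _ => (A'.hasFDerivAt.const_add _).hasFDerivWithinAt)]
  · have : A'.det = tdet a b c := by
      rw [← hdet, ← LinearMap.det_toLin']; rfl
    rw [this, ← integral_const_mul]
    congr 1
    funext y
    rw [smul_eq_mul, hA']
    rfl
  · intro y _ z _ hyz
    have h1 : triPoint a b c (y 0) (y 1) = triPoint a b c (z 0) (z 1) := by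
      rw [← hA', ← hA']; exact congrArg _ hyz
    have h2 := congrArg (fun w => tdet a w c) h1
    have h3 := congrArg (fun w => tdet a b w) h1
    simp only [tdet_triPoint_left, tdet_triPoint_right] at h2 h3
    funext i
    fin_cases i
    · exact mul_right_cancel₀ hd h2
    · exact mul_right_cancel₀ hd h3

/-- In affine coordinates the derivative along `b - a` is the `s`-derivative. For fixed `t` the line
runs from the side `a c` at `s = 0` to the side `b c` at `s = 1 - t`, at parameter `t` on both. -/
theorem integral_pderiv_direction {a b c : Plane} (hd : tdet a b c ≠ 0) (p : Poly) :
    ∫ x in convexHull ℝ ({a, b, c} : Set Plane),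
        (∑ j, (b j - a j) * val (MvPolynomial.pderiv j p) x) =
      |tdet a b c| * ((∫ t in (0 : ℝ)..1, val p (AffineMap.lineMap b c t)) -
        ∫ t in (0 : ℝ)..1, val p (AffineMap.lineMap a c t)) := by
  have hc : Continuous fun x : Plane => ∑ j, (b j - a j) * val (MvPolynomial.pderiv j p) x :=
    continuous_finsetSum _ fun j _ => continuous_const.mul (continuous_val _)
  rw [integral_triangle hd hc]
  congr 1
  have hl : ∀ x y : Plane, Continuous fun t : ℝ => val p (AffineMap.lineMap x y t) :=
    fun x y => (continuous_val p).comp AffineMap.lineMap_continuous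
  rw [← intervalIntegral.integral_sub ((hl b c).intervalIntegrable _ _)
    ((hl a c).intervalIntegrable _ _)]
  congr 1
  funext t
  have hpt : ∀ s : ℝ, triPoint a b c s t = (a + t • (c - a)) + s • (b - a) := by
    intro s; unfold triPoint; abel
  simp only [hpt]
  have hder : ∀ s : ℝ, HasDerivAt (fun s : ℝ => val p ((a + t • (c - a)) + s • (b - a)))
      (∑ j, (b j - a j) * val (MvPolynomial.pderiv j p) ((a + t • (c - a)) + s • (b - a))) s := by
    intro s
    simpa using hasDerivAt_val_line p (a + t • (c - a)) (b - a) s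
  rw [intervalIntegral.integral_eq_sub_of_hasDerivAt (fun s _ => hder s)]
  · congr 2
    · simp only [AffineMap.lineMap_apply, vsub_eq_sub, vadd_eq_add]; module
    · simp only [AffineMap.lineMap_apply, vsub_eq_sub, vadd_eq_add]; module
  · refine Continuous.intervalIntegrable ?_ _ _
    exact hc.comp (by fun_prop)

/-- The divergence theorem on a triangle, one partial derivative at a time. -/
theorem integral_pderiv_triangle {a b c : Plane} (hd : tdet a b c ≠ 0) (p : Poly) (j : Fin 2) :
    ∫ x in convexHull ℝ ({a, b, c} : Set Plane), val (MvPolynomial.pderiv j p) x =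
      outwardNormal b c a j * segIntegral (val p) b c +
      outwardNormal a b c j * segIntegral (val p) a b +
      outwardNormal a c b j * segIntegral (val p) a c := by
  have hd' : tdet a c b ≠ 0 := by rw [tdet_swap]; exact neg_ne_zero.2 hd
  have hd'' : tdet b c a ≠ 0 := by rw [tdet_rotate]; exact hd
  -- The derivatives along `b - a` and `c - a` give two linear equations for the integrals of the
  -- two partial derivatives; at the end they are solved by Cramer's rule, with determinant `tdet a
  -- b c`.
  have E1 := integral_pderiv_direction hd p
  have E2 := integral_pderiv_direction hd' p
  have hset : ({a, c, b} : Set Plane) = {a, b, c} := by rw [Set.pair_comm]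
  rw [hset, tdet_swap, abs_neg] at E2
  have hint : ∀ j, Integrable (fun x => val (MvPolynomial.pderiv j p) x)
      (volume.restrict (convexHull ℝ ({a, b, c} : Set Plane))) := fun j =>
    (continuous_val _).continuousOn.integrableOn_compact
      ((Set.toFinite _).isCompact_convexHull (𝕜 := ℝ))
  simp only [Fin.sum_univ_two] at E1 E2
  rw [integral_add ((hint 0).const_mul _) ((hint 1).const_mul _), integral_const_mul,
    integral_const_mul] at E1 E2
  have hsymm : (∫ t in (0 : ℝ)..1, val p (AffineMap.lineMap c b t)) =
      ∫ t in (0 : ℝ)..1, val p (AffineMap.lineMap b c t) := by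
    have h := segIntegral_symm (val p) c b
    unfold segIntegral at h
    rw [dist_comm] at h
    exact mul_left_cancel₀ (dist_ne_zero.2 (ne_of_tdet_ne_zero hd'')) h
  rw [hsymm, ← orient_mul_tdet] at E2
  rw [← orient_mul_tdet] at E1
  unfold segIntegral
  set Ibc := ∫ t in (0 : ℝ)..1, val p (AffineMap.lineMap b c t)
  set Iac := ∫ t in (0 : ℝ)..1, val p (AffineMap.lineMap a c t)
  set Iab := ∫ t in (0 : ℝ)..1, val p (AffineMap.lineMap a b t)
  set J0 := ∫ x in convexHull ℝ ({a, b, c} : Set Plane), val (MvPolynomial.pderiv 0 p) x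
  set J1 := ∫ x in convexHull ℝ ({a, b, c} : Set Plane), val (MvPolynomial.pderiv 1 p) x
  have n0 := dist_mul_outwardNormal_zero (ne_of_tdet_ne_zero hd'') a
  have n1 := dist_mul_outwardNormal_one (ne_of_tdet_ne_zero hd'') a
  have n2 := dist_mul_outwardNormal_zero (ne_of_tdet_ne_zero hd) c
  have n3 := dist_mul_outwardNormal_one (ne_of_tdet_ne_zero hd) c
  have n4 := dist_mul_outwardNormal_zero (ne_of_tdet_ne_zero hd') b
  have n5 := dist_mul_outwardNormal_one (ne_of_tdet_ne_zero hd') b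
  rw [orient_rotate] at n0 n1
  rw [orient_swap hd] at n4 n5
  set σ := orient a b c
  have hT : tdet a b c = (b 0 - a 0) * (c 1 - a 1) - (b 1 - a 1) * (c 0 - a 0) := rfl
  fin_cases j
  · apply mul_left_cancel₀ hd
    change _ * J0 = _ * (outwardNormal b c a 0 * _ + outwardNormal a b c 0 * _ +
      outwardNormal a c b 0 * _)
    linear_combination (c 1 - a 1) * E1 - (b 1 - a 1) * E2 - tdet a b c * Ibc * n0
      - tdet a b c * Iab * n2 - tdet a b c * Iac * n4 + J0 * hT
  · apply mul_left_cancel₀ hd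
    change _ * J1 = _ * (outwardNormal b c a 1 * _ + outwardNormal a b c 1 * _ +
      outwardNormal a c b 1 * _)
    linear_combination -(c 0 - a 0) * E1 + (b 0 - a 0) * E2 - tdet a b c * Ibc * n1
      - tdet a b c * Iab * n3 - tdet a b c * Iac * n5 + J1 * hT

/-! ### Integrals as linear functionals on polynomials -/

/-- A constant vector, as a vector of polynomials. -/
def CV (n : Fin 2 → ℝ) : Fin 2 → Poly := fun i => MvPolynomial.C (n i)

theorem val_add (p q : Poly) (x : Plane) : val (p + q) x = val p x + val q x := by simp [val]

theorem val_mul (p q : Poly) (x : Plane) : val (p * q) x = val p x * val q x := by simp [val]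

theorem val_smul (r : ℝ) (p : Poly) (x : Plane) : val (r • p) x = r * val p x := by simp [val]

theorem val_C (r : ℝ) (x : Plane) : val (MvPolynomial.C r) x = r := by simp [val]

theorem val_sum {ι : Type*} (s : Finset ι) (p : ι → Poly) (x : Plane) :
    val (∑ i ∈ s, p i) x = ∑ i ∈ s, val (p i) x := by simp [val]

theorem vval_CV (n : Fin 2 → ℝ) (x : Plane) : vval (CV n) x = n := by
  funext i; simp [vval, CV, val_C]

theorem val_dotProduct (u v : Fin 2 → Poly) (x : Plane) :
    val (u ⬝ᵥ v) x = vval u x ⬝ᵥ vval v x := by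
  simp only [dotProduct, val_sum, val_mul, vval]

theorem vval_mulVec (G : Matrix (Fin 2) (Fin 2) Poly) (v : Fin 2 → Poly) (x : Plane) :
    vval (G *ᵥ v) x = mval G x *ᵥ vval v x := by
  funext i
  simp only [vval, mulVec, mval, dotProduct, val_sum, val_mul, of_apply]

theorem vval_add (u v : Fin 2 → Poly) (x : Plane) : vval (u + v) x = vval u x + vval v x := by
  funext i; simp [vval, val_add]

theorem vval_smul (r : ℝ) (v : Fin 2 → Poly) (x : Plane) : vval (r • v) x = r • vval v x := by
  funext i; simp [vval, val_smul]

theorem edgeSet_mk (a b : Plane) : edgeSet s(a, b) = segment ℝ a b := by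
  rw [← convexHull_pair]
  unfold edgeSet
  congr 1
  ext x; simp

theorem edgeIntegral_mk (φ : Plane → ℝ) (a b : Plane) :
    edgeIntegral s(a, b) φ = segIntegral φ a b := rfl

theorem edgeIntegral_congr {e : Sym2 Plane} {φ ψ : Plane → ℝ} (h : ∀ x ∈ edgeSet e, φ x = ψ x) :
    edgeIntegral e φ = edgeIntegral e ψ := by
  induction e using Sym2.ind with
  | _ a b =>
    rw [edgeIntegral_mk, edgeIntegral_mk, segIntegral, segIntegral]
    congr 1
    refine intervalIntegral.integral_congr fun s hs => h _ ?_
    rw [Set.uIcc_of_le zero_le_one] at hs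
    rw [edgeSet_mk, segment_eq_image_lineMap]
    exact ⟨s, hs, rfl⟩

theorem segIntegral_add (p q : Poly) (a b : Plane) :
    segIntegral (val (p + q)) a b = segIntegral (val p) a b + segIntegral (val q) a b := by
  have hl : ∀ p : Poly, IntervalIntegrable (fun t : ℝ => val p (AffineMap.lineMap a b t))
      volume 0 1 :=
    fun p => ((continuous_val p).comp AffineMap.lineMap_continuous).intervalIntegrable _ _
  unfold segIntegral
  rw [← mul_add, ← intervalIntegral.integral_add (hl p) (hl q)]
  simp only [val_add]

theorem segIntegral_smul (r : ℝ) (p : Poly) (a b : Plane) :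
    segIntegral (val (r • p)) a b = r * segIntegral (val p) a b := by
  unfold segIntegral
  simp only [val_smul, intervalIntegral.integral_const_mul]
  ring

/-- The integral over an edge, on polynomials. -/
def edgeInt (e : Sym2 Plane) : Poly →ₗ[ℝ] ℝ where
  toFun p := edgeIntegral e (val p)
  map_add' p q := by
    induction e using Sym2.ind with
    | _ a b => exact segIntegral_add p q a b
  map_smul' r p := by
    induction e using Sym2.ind with
    | _ a b => exact segIntegral_smul r p a b

/-- Agreement on the edge alone suffices; through this the continuity conditions of the discrete
spaces, which hold only there, enter the integrals. -/
theorem edgeInt_congr {e : Sym2 Plane} {p q : Poly} (h : ∀ x ∈ edgeSet e, val p x = val q x) :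
    edgeInt e p = edgeInt e q := edgeIntegral_congr h

namespace Mesh

variable {Ω : Set Plane} (M : Mesh Ω)

theorem tdet_ne_zero (τ : M.Tri) : tdet (M.center τ.1) (M.fst τ) (M.snd τ) ≠ 0 :=
  SDG.tdet_ne_zero (M.nondegenerate τ.1 τ.2)

theorem fst_ne_snd (τ : M.Tri) : M.fst τ ≠ M.snd τ := by
  refine ne_of_tdet_ne_zero (c := M.center τ.1) ?_
  rw [tdet_rotate]
  exact M.tdet_ne_zero τ

theorem center_ne_vertex (e : M.DualEdge) : M.center e.1 ≠ M.vertex e.1 e.2 :=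
  ne_of_tdet_ne_zero (M.tdet_ne_zero e)

theorem isCompact_triSet (τ : M.Tri) : IsCompact (M.triSet τ) :=
  (Set.toFinite _).isCompact_convexHull (𝕜 := ℝ)

/-- The integral over a triangle with an integrable weight, on polynomials. -/
def weightInt (τ : M.Tri) (h : Plane → ℝ) (hh : IntegrableOn h (M.triSet τ)) : Poly →ₗ[ℝ] ℝ where
  toFun p := ∫ x in M.triSet τ, h x * val p x
  map_add' p q := by
    have hi : ∀ p : Poly, IntegrableOn (fun x => h x * val p x) (M.triSet τ) := fun p =>
      hh.mul_continuousOn (continuous_val p).continuousOn (M.isCompact_triSet τ)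
    rw [← integral_add (hi p) (hi q)]
    simp only [val_add, mul_add]
  map_smul' r p := by
    simp only [val_smul, smul_eq_mul, RingHom.id_apply]
    rw [← integral_const_mul]
    congr 1
    funext x
    ring

/-- The integral over a triangle, on polynomials. -/
def triInt (τ : M.Tri) : Poly →ₗ[ℝ] ℝ where
  toFun p := ∫ x in M.triSet τ, val p x
  map_add' p q := by
    rw [← integral_add (M.integrableOn_val p τ) (M.integrableOn_val q τ)]
    simp only [val_add]
  map_smul' r p := by
    simp only [val_smul, smul_eq_mul, RingHom.id_apply]
    rw [← integral_const_mul]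

theorem triInt_apply (τ : M.Tri) (p : Poly) : M.triInt τ p = ∫ x in M.triSet τ, val p x := rfl

theorem integral_eq_sum {φ : M.Tri → Plane → ℝ} {P : M.Tri → Poly}
    (h : ∀ τ x, φ τ x = val (P τ) x) : M.integral φ = ∑ τ, M.triInt τ (P τ) := by
  simp only [integral, h, triInt_apply]

theorem dualIntegral_eq_sum {φ : M.DualEdge → Plane → ℝ} {P : M.DualEdge → Poly}
    (h : ∀ e x, x ∈ edgeSet (M.dualSym e) → φ e x = val (P e) x) :
    M.dualIntegral φ = ∑ e, edgeInt (M.dualSym e) (P e) :=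
  Finset.sum_congr rfl fun e _ => edgeIntegral_congr (h e)

-- Each triangle has exactly one primal edge, so a sum over primal edges of sums over their
-- triangles is a sum over all triangles.
open Classical in
theorem primalIntegral_eq_sum {φ : M.PrimalEdge → Plane → ℝ} {P : M.Tri → Poly}
    (h : ∀ (e : M.PrimalEdge) (x), x ∈ edgeSet e.1 →
      φ e x = ∑ τ : M.Tri with M.primalEdge τ = e, val (P τ) x) :
    M.primalIntegral φ = ∑ τ, edgeInt (M.primalEdge τ).1 (P τ) := by
  rw [← Finset.sum_fiberwise Finset.univ M.primalEdge]
  refine Finset.sum_congr rfl fun e _ => ?_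
  have : edgeIntegral e.1 (φ e) = edgeInt e.1 (∑ τ : M.Tri with M.primalEdge τ = e, P τ) := by
    refine edgeIntegral_congr fun x hx => ?_
    rw [h e x hx, val_sum]
  rw [this, map_sum]
  refine Finset.sum_congr rfl fun τ hτ => ?_
  rw [(Finset.mem_filter.1 hτ).2]

/-! ### The divergence theorem on a mesh -/

/-- The next triangle, or the next dual edge, in the same cell. -/
def next : M.Tri ≃ M.Tri := Equiv.sigmaCongrRight fun c => finRotate (M.sides c)

theorem before_next (τ : M.Tri) : M.before (M.next τ) = τ := by
  obtain ⟨c, i⟩ := τ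
  change (⟨c, (finRotate _).symm (finRotate _ i)⟩ : M.Tri) = ⟨c, i⟩
  rw [Equiv.symm_apply_apply]

theorem snd_before (e : M.DualEdge) : M.snd (M.before e) = M.vertex e.1 e.2 := by
  change M.vertex e.1 (finRotate _ ((finRotate _).symm e.2)) = _
  rw [Equiv.apply_symm_apply]

theorem normalBefore_next (τ : M.Tri) :
    M.normalBefore (M.next τ) = outwardNormal (M.center τ.1) (M.snd τ) (M.fst τ) := by
  change outwardNormal (M.center τ.1) (M.snd τ)
    (M.vertex τ.1 ((finRotate _).symm (finRotate _ τ.2))) = _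
  rw [Equiv.symm_apply_apply]
  rfl

/-- A triangle and its first dual edge share an index; its second dual edge is `next τ`, which sees
the triangle on its `before` side. -/
theorem triInt_pderiv (τ : M.Tri) (p : Poly) (j : Fin 2) :
    M.triInt τ (MvPolynomial.pderiv j p) =
      M.normalPrimal τ j * edgeInt (M.primalEdge τ).1 p +
      M.normalAfter τ j * edgeInt (M.dualSym τ) p +
      M.normalBefore (M.next τ) j * edgeInt (M.dualSym (M.next τ)) p := by
  rw [normalBefore_next]
  exact integral_pderiv_triangle (M.tdet_ne_zero τ) p j

theorem triInt_dvg (τ : M.Tri) (F : Fin 2 → Poly) :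
    M.triInt τ (dvg F) =
      edgeInt (M.primalEdge τ).1 (F ⬝ᵥ CV (M.normalPrimal τ)) +
      edgeInt (M.dualSym τ) (F ⬝ᵥ CV (M.normalAfter τ)) +
      edgeInt (M.dualSym (M.next τ)) (F ⬝ᵥ CV (M.normalBefore (M.next τ))) := by
  have hC : ∀ (p : Poly) (r : ℝ), p * MvPolynomial.C r = r • p := fun p r => by
    rw [mul_comm, MvPolynomial.smul_eq_C_mul]
  simp only [dvg, dotProduct, CV, Fin.sum_univ_two, map_add, triInt_pderiv, hC, map_smul,
    smul_eq_mul]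
  ring

/-- Since `next` is a bijection, the contributions of second dual edges can be reindexed and
collected with those of first dual edges, two on each dual edge. -/
theorem sum_triInt_dvg (F : M.Tri → Fin 2 → Poly) :
    ∑ τ, M.triInt τ (dvg (F τ)) =
      ∑ τ, edgeInt (M.primalEdge τ).1 (F τ ⬝ᵥ CV (M.normalPrimal τ)) +
      ∑ e, edgeInt (M.dualSym e) (F (M.before e) ⬝ᵥ CV (M.normalBefore e) +
        F (M.after e) ⬝ᵥ CV (M.normalAfter e)) := by
  have h := Equiv.sum_comp M.next fun e : M.Tri =>
    edgeInt (M.dualSym e) (F (M.before e) ⬝ᵥ CV (M.normalBefore e))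
  simp only [before_next] at h
  simp only [triInt_dvg, Finset.sum_add_distrib, map_add, h, after]
  ring

/-! ### Edges and their triangles -/

theorem orient_eq_of_outwardNormal_eq {a b c c' : Plane} (hab : a ≠ b)
    (h : outwardNormal a b c = outwardNormal a b c') : orient a b c = orient a b c' := by
  have h0 := dist_mul_outwardNormal_zero hab c
  have h1 := dist_mul_outwardNormal_one hab c
  rw [h] at h0 h1
  rw [dist_mul_outwardNormal_zero hab] at h0
  rw [dist_mul_outwardNormal_one hab] at h1
  by_contra hne
  apply hab
  have hne' : orient a b c - orient a b c' ≠ 0 := sub_ne_zero.2 hne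
  apply plane_ext <;> apply mul_left_cancel₀ hne' <;> linarith

theorem tdet_mul_pos_of_orient_eq {a b c c' : Plane} (hc : tdet a b c ≠ 0)
    (hc' : tdet a b c' ≠ 0) (h : orient a b c = orient a b c') :
    0 < tdet a b c * tdet a b c' := by
  unfold orient at h
  split_ifs at h with h1 h2 h2
  · exact mul_pos h1 h2
  · norm_num at h
  · norm_num at h
  · exact mul_pos_of_neg_of_neg (lt_of_le_of_ne (not_lt.1 h1) hc) (lt_of_le_of_ne (not_lt.1 h2) hc')

/-- Equal outward normals on a common edge put both triangles on the same side of it, where distinct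
triangles would overlap. The two cases are the two orders of the endpoints. -/
theorem eq_of_normalPrimal_eq {τ τ' : M.Tri} (he : M.primalEdge τ = M.primalEdge τ')
    (hn : M.normalPrimal τ = M.normalPrimal τ') : τ = τ' := by
  by_contra hne
  have hdis := M.disjoint_interior τ τ' hne
  have h1 : tdet (M.fst τ) (M.snd τ) (M.center τ.1) ≠ 0 := by
    rw [tdet_rotate]; exact M.tdet_ne_zero τ
  have h2 : tdet (M.fst τ') (M.snd τ') (M.center τ'.1) ≠ 0 := by
    rw [tdet_rotate]; exact M.tdet_ne_zero τ'
  have hset : ∀ x y z : Plane, ({x, y, z} : Set Plane) = {y, z, x} := by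
    intro x y z; ext w; simp only [Set.mem_insert_iff, Set.mem_singleton_iff]; tauto
  change Disjoint (interior (convexHull ℝ {M.center τ.1, M.fst τ, M.snd τ}))
    (interior (convexHull ℝ {M.center τ'.1, M.fst τ', M.snd τ'})) at hdis
  rw [hset, hset (M.center τ'.1)] at hdis
  have he' : s(M.fst τ, M.snd τ) = s(M.fst τ', M.snd τ') := congrArg Subtype.val he
  unfold normalPrimal at hn
  rw [Sym2.eq_iff] at he'
  rcases he' with ⟨ha, hb⟩ | ⟨ha, hb⟩
  · rw [← ha, ← hb] at h2 hn hdis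
    exact not_disjoint_interior_of_same_side
      (tdet_mul_pos_of_orient_eq h1 h2 (orient_eq_of_outwardNormal_eq (M.fst_ne_snd τ) hn)) hdis
  · rw [← outwardNormal_symm h2] at hn
    have h2' : tdet (M.snd τ') (M.fst τ') (M.center τ'.1) ≠ 0 := by
      rw [← tdet_rotate, tdet_swap]; exact neg_ne_zero.2 h2
    have hs : ({M.fst τ', M.snd τ', M.center τ'.1} : Set Plane) =
        {M.snd τ', M.fst τ', M.center τ'.1} := Set.insert_comm _ _ _
    rw [hs] at hdis
    rw [← ha, ← hb] at h2' hn hdis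
    exact not_disjoint_interior_of_same_side
      (tdet_mul_pos_of_orient_eq h1 h2' (orient_eq_of_outwardNormal_eq (M.fst_ne_snd τ) hn)) hdis

theorem primalEdge_side (e : M.PrimalEdge) : M.primalEdge (M.side e) = e :=
  Subtype.ext e.2.choose_spec

theorem before_ne_after (e : M.DualEdge) : M.before e ≠ M.after e := by
  intro h
  have h' : (finRotate (M.sides e.1)).symm e.2 = e.2 := by
    simpa [before, after, Sigma.ext_iff] using h
  have h'' : finRotate (M.sides e.1) e.2 = e.2 := by
    rw [Equiv.symm_apply_eq] at h'; exact h'.symm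
  apply M.fst_ne_snd e
  simp only [fst, snd, h'']

theorem tdet_after_ne_zero (e : M.DualEdge) :
    tdet (M.center e.1) (M.vertex e.1 e.2) (M.vertex e.1 (finRotate _ e.2)) ≠ 0 :=
  M.tdet_ne_zero e

theorem tdet_before_ne_zero (e : M.DualEdge) :
    tdet (M.center e.1) (M.vertex e.1 e.2) (M.vertex e.1 ((finRotate _).symm e.2)) ≠ 0 := by
  have h := M.tdet_ne_zero (M.before e)
  rw [snd_before] at h
  rw [tdet_swap]
  exact neg_ne_zero.2 h

theorem normalBefore_ne_normalAfter (e : M.DualEdge) : M.normalBefore e ≠ M.normalAfter e := by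
  intro h
  have hdis := M.disjoint_interior _ _ (M.before_ne_after e)
  change Disjoint (interior (convexHull ℝ {M.center e.1, M.fst (M.before e), M.snd (M.before e)}))
    _ at hdis
  rw [snd_before, Set.pair_comm (M.fst (M.before e))] at hdis
  exact not_disjoint_interior_of_same_side (tdet_mul_pos_of_orient_eq (M.tdet_before_ne_zero e)
    (M.tdet_after_ne_zero e) (orient_eq_of_outwardNormal_eq (M.center_ne_vertex e) h)) hdis

namespace EdgeNormals

variable {M} (N : M.EdgeNormals)

/-- The fixed normal of a boundary edge is the outward normal of every triangle that has this edge,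
so there is only one such triangle. This is needed because `W^h` and `P^h` impose no condition on
boundary edges. -/
theorem side_eq_of_boundary (N : M.EdgeNormals) {e : M.PrimalEdge} (he : ¬ M.IsInteriorEdge e) {τ : M.Tri}
    (hτ : M.primalEdge τ = e) : M.side e = τ := by
  subst hτ
  have h1 := N.primal_outward τ he
  have hs := M.primalEdge_side (M.primalEdge τ)
  have h2 := N.primal_outward (M.side (M.primalEdge τ)) (by rw [hs]; exact he)
  rw [hs] at h2
  exact M.eq_of_normalPrimal_eq hs (h2.symm.trans h1)

theorem normalPrimal_eq (τ : M.Tri) : M.normalPrimal τ =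
    (M.normalPrimal τ ⬝ᵥ N.primal (M.primalEdge τ)) • N.primal (M.primalEdge τ) :=
  (isUnitNormal_outwardNormal (M.fst_ne_snd τ) _).eq_smul (M.fst_ne_snd τ)
    (N.primal_isUnitNormal τ)

theorem normalBefore_eq (e : M.DualEdge) :
    M.normalBefore e = (M.normalBefore e ⬝ᵥ N.dual e) • N.dual e :=
  (isUnitNormal_outwardNormal (M.center_ne_vertex e) _).eq_smul (M.center_ne_vertex e)
    (N.dual_isUnitNormal e)

theorem normalAfter_eq (e : M.DualEdge) :
    M.normalAfter e = (M.normalAfter e ⬝ᵥ N.dual e) • N.dual e :=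
  (isUnitNormal_outwardNormal (M.center_ne_vertex e) _).eq_smul (M.center_ne_vertex e)
    (N.dual_isUnitNormal e)

/-- The two triangles of a dual edge lie on opposite sides of it. -/
theorem sign_before_add_sign_after (e : M.DualEdge) :
    M.normalBefore e ⬝ᵥ N.dual e + M.normalAfter e ⬝ᵥ N.dual e = 0 := by
  have hB := (isUnitNormal_outwardNormal (M.center_ne_vertex e)
    (M.vertex e.1 ((finRotate _).symm e.2))).dotProduct_sq (M.center_ne_vertex e)
    (N.dual_isUnitNormal e)
  have hA := (isUnitNormal_outwardNormal (M.center_ne_vertex e)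
    (M.vertex e.1 (finRotate _ e.2))).dotProduct_sq (M.center_ne_vertex e)
    (N.dual_isUnitNormal e)
  change (M.normalBefore e ⬝ᵥ N.dual e) * (M.normalBefore e ⬝ᵥ N.dual e) = 1 at hB
  change (M.normalAfter e ⬝ᵥ N.dual e) * (M.normalAfter e ⬝ᵥ N.dual e) = 1 at hA
  have hne : M.normalBefore e ⬝ᵥ N.dual e ≠ M.normalAfter e ⬝ᵥ N.dual e := by
    intro h
    apply M.normalBefore_ne_normalAfter e
    rw [N.normalBefore_eq, N.normalAfter_eq, h]
  have : (M.normalBefore e ⬝ᵥ N.dual e - M.normalAfter e ⬝ᵥ N.dual e) *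
      (M.normalBefore e ⬝ᵥ N.dual e + M.normalAfter e ⬝ᵥ N.dual e) = 0 := by
    linear_combination hB - hA
  exact (mul_eq_zero.1 this).resolve_left (sub_ne_zero.2 hne)

theorem sign_after_sq (e : M.DualEdge) :
    (M.normalAfter e ⬝ᵥ N.dual e) * (M.normalAfter e ⬝ᵥ N.dual e) = 1 :=
  (isUnitNormal_outwardNormal (M.center_ne_vertex e) _).dotProduct_sq (M.center_ne_vertex e)
    (N.dual_isUnitNormal e)

end EdgeNormals

end Mesh

namespace Mesh

namespace EdgeNormals

variable {Ω : Set Plane} {M : Mesh Ω} (N : M.EdgeNormals)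

/-! ### The forms as sums of linear functionals of polynomials -/

theorem formBstar_eq (v : M.VectorField) (G : M.TensorField) :
    N.formBstar v G = -∑ τ, M.triInt τ (v τ ⬝ᵥ mdvg (G τ)) +
      ∑ e, edgeInt (M.dualSym e) ((v (M.after e) ⬝ᵥ CV (N.dual e)) *
        (CV (N.dual e) ⬝ᵥ N.jumpDual (fun τ => G τ *ᵥ CV (N.dual e)) e)) := by
  unfold formBstar
  rw [M.integral_eq_sum (P := fun τ => v τ ⬝ᵥ mdvg (G τ)) fun τ x => (val_dotProduct _ _ _).symm,
    M.dualIntegral_eq_sum]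
  intro e x _
  simp only [jumpDual, val_mul, val_dotProduct, vval_CV, vval_add, vval_smul, vval_mulVec]

theorem formb_eq (v : M.VectorField) (q : M.ScalarField) :
    N.formb v q = ∑ τ, M.triInt τ (v τ ⬝ᵥ grad (q τ)) -
      ∑ e, edgeInt (M.dualSym e) ((v (M.after e) ⬝ᵥ CV (N.dual e)) * N.jumpDual q e) := by
  unfold formb
  rw [M.integral_eq_sum (P := fun τ => v τ ⬝ᵥ grad (q τ)) fun τ x => (val_dotProduct _ _ _).symm,
    M.dualIntegral_eq_sum]
  intro e x _
  simp only [jumpDual, val_mul, val_dotProduct, vval_CV, val_add, val_smul, smul_eq_mul]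

/-- The polynomial in the plane that extends a polynomial in the affine parameter of the segment
from `a` to `b`, constantly in the normal direction. -/
def extend (a b : Plane) (r : Polynomial ℝ) : Poly :=
  Polynomial.aeval (∑ i, MvPolynomial.C ((b i - a i) / ‖b - a‖ ^ 2) *
    (MvPolynomial.X i - MvPolynomial.C (a i)) : Poly) r

theorem val_extend (a b : Plane) (r : Polynomial ℝ) (x : Plane) :
    val (extend a b r) x = r.eval (edgeParam a b x) := by
  have h : edgeParam a b x = MvPolynomial.aeval x.ofLp
      (∑ i, MvPolynomial.C ((b i - a i) / ‖b - a‖ ^ 2) *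
        (MvPolynomial.X i - MvPolynomial.C (a i)) : Poly) := by
    simp [edgeParam, Fin.sum_univ_two, PiLp.inner_apply]
    ring
  rw [h, val, extend, ← MvPolynomial.coe_aeval_eq_eval, RingHom.coe_coe,
    ← Polynomial.aeval_algHom_apply, Polynomial.coe_aeval_eq_eval]

/-- The extension of the components of an edge field to the plane. -/
def extendField (w : M.EdgeField) (e : M.DualEdge) : Fin 2 → Poly :=
  fun i => extend (M.center e.1) (M.vertex e.1 e.2) (w e i)

theorem vval_extendField (w : M.EdgeField) (e : M.DualEdge) (x : Plane) :
    vval (extendField w e) x = M.eval w e x := by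
  funext i; exact val_extend _ _ _ _

theorem formTstar_eq (w : M.EdgeField) (G : M.TensorField) :
    N.formTstar w G = ∑ e, edgeInt (M.dualSym e) (extendField w e ⬝ᵥ
      N.jumpDual (fun τ => G τ *ᵥ CV (N.dual e)) e) := by
  unfold formTstar
  rw [M.dualIntegral_eq_sum]
  intro e x _
  simp only [jumpDual, val_dotProduct, vval_extendField, vval_CV, vval_add, vval_smul,
    vval_mulVec]

theorem formT_eq_formTstar (G : M.TensorField) (w : M.EdgeField) :
    N.formT G w = N.formTstar w G := by
  unfold formT formTstar
  simp only [dotProduct_comm]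

/-! ### Discrete integration by parts -/

/-- Makes the choice in `side` harmless: interior edges carry a continuity condition, boundary edges
have a single triangle. -/
theorem val_side {k : ℕ} {q : M.ScalarField} (hq : q ∈ M.pressureSpace k) (N : M.EdgeNormals)
    {e : M.PrimalEdge} {τ : M.Tri} (hτ : M.primalEdge τ = e) {x : Plane} (hx : x ∈ edgeSet e.1) :
    val (q (M.side e)) x = val (q τ) x := by
  by_cases he : M.IsInteriorEdge e
  · exact hq.2.1 e he _ _ (M.primalEdge_side e) hτ x hx
  · rw [N.side_eq_of_boundary he hτ]

theorem mval_side {k : ℕ} {G : M.TensorField} (hG : G ∈ N.gradientSpace k)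
    {e : M.PrimalEdge} {τ : M.Tri} (hτ : M.primalEdge τ = e) {x : Plane} (hx : x ∈ edgeSet e.1) :
    mval (G (M.side e)) x *ᵥ N.primal e = mval (G τ) x *ᵥ N.primal e := by
  by_cases he : M.IsInteriorEdge e
  · exact hG.2 e he _ _ (M.primalEdge_side e) hτ x hx
  · rw [N.side_eq_of_boundary he hτ]

/-- The divergence theorem for `q v`. On primal edges `q` is single-valued and factors out of the
jump; on dual edges `v · n` is and does. -/
theorem formbstar_eq_formb {k : ℕ} {v : M.VectorField} (hv : v ∈ N.velocitySpace k)
    {q : M.ScalarField} (hq : q ∈ M.pressureSpace k) : N.formbstar q v = N.formb v q := by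
  have hdiv := M.sum_triInt_dvg fun τ j => q τ * v τ j
  have hd : ∀ τ, dvg (fun j => q τ * v τ j) = v τ ⬝ᵥ grad (q τ) + q τ * dvg (v τ) := by
    intro τ
    simp only [dvg, grad, dotProduct, Derivation.leibniz, smul_eq_mul, Fin.sum_univ_two]
    ring
  simp only [hd, map_add, Finset.sum_add_distrib] at hdiv
  rw [formb_eq, formbstar, M.integral_eq_sum (P := fun τ => q τ * dvg (v τ))
    fun τ x => (val_mul _ _ _).symm, M.primalIntegral_eq_sum
    (P := fun τ => (fun j => q τ * v τ j) ⬝ᵥ CV (M.normalPrimal τ))]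
  · have : ∀ e, edgeInt (M.dualSym e) ((v (M.after e) ⬝ᵥ CV (N.dual e)) * N.jumpDual q e) =
        edgeInt (M.dualSym e) ((fun j => q (M.before e) * v (M.before e) j) ⬝ᵥ
          CV (M.normalBefore e)) + edgeInt (M.dualSym e)
          ((fun j => q (M.after e) * v (M.after e) j) ⬝ᵥ CV (M.normalAfter e)) := by
      intro e
      rw [← map_add]
      refine edgeInt_congr fun x hx => ?_
      have h := hv.2 e x hx
      simp only [val_add, val_dotProduct, vval_CV]
      rw [N.normalBefore_eq e, N.normalAfter_eq e]
      simp only [jumpDual, val_mul, val_add, val_smul, val_dotProduct, vval_CV]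
      simp only [dotProduct_smul, smul_eq_mul]
      set δ := M.normalBefore e ⬝ᵥ N.dual e
      set δ' := M.normalAfter e ⬝ᵥ N.dual e
      simp only [vval, dotProduct, Fin.sum_univ_two, val_mul] at h ⊢
      linear_combination -δ * val (q (M.before e)) x * h
    simp only [this, Finset.sum_add_distrib]
    linarith
  · intro e x hx
    rw [jumpPrimal, Finset.mul_sum]
    refine Finset.sum_congr rfl fun τ hτ => ?_
    have hτ' := (Finset.mem_filter.1 hτ).2
    rw [val_side hq N hτ' hx, val_dotProduct, vval_CV]
    subst hτ'
    conv_rhs => rw [N.normalPrimal_eq τ]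
    simp only [dotProduct_smul, smul_eq_mul]
    set δ := M.normalPrimal τ ⬝ᵥ N.primal (M.primalEdge τ)
    simp only [vval, dotProduct, Fin.sum_univ_two, val_mul]
    ring

/-- The divergence theorem for `Gᵀ v`. On primal edges `G n` is single-valued. On dual edges `v · G
n` splits into a normal part, where `v · n` is single-valued and which belongs to `B_h^*`, and a
tangential part, which stays in `B_h`. -/
theorem formB_eq_formBstar {k : ℕ} {v : M.VectorField} (hv : v ∈ N.velocitySpace k)
    {G : M.TensorField} (hG : G ∈ N.gradientSpace k) : N.formB G v = N.formBstar v G := by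
  have hdiv := M.sum_triInt_dvg fun τ => v τ ᵥ* G τ
  have hd : ∀ τ, dvg (v τ ᵥ* G τ) = v τ ⬝ᵥ mdvg (G τ) +
      ∑ i, ∑ j, G τ i j * vgrad (v τ) i j := by
    intro τ
    simp only [dvg, mdvg, vgrad, vecMul, dotProduct, Derivation.leibniz, smul_eq_mul,
      Fin.sum_univ_two, map_add, of_apply]
    ring
  simp only [hd, map_add, Finset.sum_add_distrib] at hdiv
  rw [formBstar_eq, formB, M.integral_eq_sum (P := fun τ => ∑ i, ∑ j, G τ i j * vgrad (v τ) i j),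
    M.primalIntegral_eq_sum (P := fun τ => (v τ ᵥ* G τ) ⬝ᵥ CV (M.normalPrimal τ)),
    M.dualIntegral_eq_sum (P := fun e => N.jumpDual
      (fun τ => (v τ ⬝ᵥ CV (tangent (N.dual e))) *
        (CV (tangent (N.dual e)) ⬝ᵥ (G τ *ᵥ CV (N.dual e)))) e)]
  · have : ∀ e, edgeInt (M.dualSym e) ((v (M.after e) ⬝ᵥ CV (N.dual e)) *
          (CV (N.dual e) ⬝ᵥ N.jumpDual (fun τ => G τ *ᵥ CV (N.dual e)) e)) =
        edgeInt (M.dualSym e) ((v (M.before e) ᵥ* G (M.before e)) ⬝ᵥ CV (M.normalBefore e)) +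
        edgeInt (M.dualSym e) ((v (M.after e) ᵥ* G (M.after e)) ⬝ᵥ CV (M.normalAfter e)) -
        edgeInt (M.dualSym e) (N.jumpDual (fun τ => (v τ ⬝ᵥ CV (tangent (N.dual e))) *
        (CV (tangent (N.dual e)) ⬝ᵥ (G τ *ᵥ CV (N.dual e)))) e) := by
      intro e
      rw [← map_add, eq_sub_iff_add_eq, ← map_add]
      refine edgeInt_congr fun x hx => ?_
      have h := hv.2 e x hx
      have hn := (N.dual_isUnitNormal e).1
      simp only [val_add, val_dotProduct, vval_CV, val_mul]
      rw [N.normalBefore_eq e, N.normalAfter_eq e]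
      simp only [jumpDual, val_mul, val_add, val_smul, val_dotProduct, vval_CV, vval_add,
        vval_smul, vval_mulVec]
      simp only [dotProduct_smul, smul_eq_mul]
      set δ := M.normalBefore e ⬝ᵥ N.dual e
      set δ' := M.normalAfter e ⬝ᵥ N.dual e
      simp only [tangent, mval, vval, vecMul, mulVec, dotProduct, Fin.sum_univ_two, val_mul,
        val_add, Pi.add_apply, Pi.smul_apply, smul_eq_mul, of_apply, cons_val_zero, cons_val_one]
        at h hn ⊢
      set n0 := N.dual e 0
      set n1 := N.dual e 1
      set a00 := val (G (M.before e) 0 0) x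
      set a01 := val (G (M.before e) 0 1) x
      set a10 := val (G (M.before e) 1 0) x
      set a11 := val (G (M.before e) 1 1) x
      set b00 := val (G (M.after e) 0 0) x
      set b01 := val (G (M.after e) 0 1) x
      set b10 := val (G (M.after e) 1 0) x
      set b11 := val (G (M.after e) 1 1) x
      set u0 := val (v (M.before e) 0) x
      set u1 := val (v (M.before e) 1) x
      set w0 := val (v (M.after e) 0) x
      set w1 := val (v (M.after e) 1) x
      -- The multiple of `h` replaces the normal component of `v` on one side by that on the other;
      -- the multiple of `hn` uses `|n| = 1` to split `v · G n` along `n` and the tangent.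
      linear_combination -δ * (n0 * (a00 * n0 + a01 * n1) + n1 * (a10 * n0 + a11 * n1)) * h +
        (δ * (u0 * (a00 * n0 + a01 * n1) + u1 * (a10 * n0 + a11 * n1)) +
        δ' * (w0 * (b00 * n0 + b01 * n1) + w1 * (b10 * n0 + b11 * n1))) * hn
    simp only [this, Finset.sum_add_distrib, Finset.sum_sub_distrib]
    linarith
  · intro e x _
    simp only [jumpDual, val_mul, val_dotProduct, vval_CV, val_add, val_smul, smul_eq_mul,
      vval_mulVec]
  · intro e x hx
    rw [jumpPrimal, sum_dotProduct]
    refine Finset.sum_congr rfl fun τ hτ => ?_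
    have hτ' := (Finset.mem_filter.1 hτ).2
    rw [N.mval_side hG hτ' hx, val_dotProduct, vval_CV]
    subst hτ'
    conv_rhs => rw [N.normalPrimal_eq τ]
    simp only [dotProduct_smul, smul_dotProduct, smul_eq_mul]
    set δ := M.normalPrimal τ ⬝ᵥ N.primal (M.primalEdge τ)
    simp only [vval, mval, vecMul, mulVec, dotProduct, Fin.sum_univ_two, val_mul, val_add,
      of_apply]
    ring
  · intro τ x
    simp only [ddot, mval, val_sum, val_mul, of_apply]

end EdgeNormals

end Mesh

/-! ### Polynomials that vanish -/

/-- An open set contains a product of two infinite sets, on which only the zero polynomial vanishes.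
-/
theorem poly_eq_zero_of_isOpen {U : Set Plane} (hU : IsOpen U) (hne : U.Nonempty) {p : Poly}
    (h : ∀ x ∈ U, val p x = 0) : p = 0 := by
  obtain ⟨x, hx⟩ := hne
  have hV : IsOpen (WithLp.toLp 2 ⁻¹' U : Set (Fin 2 → ℝ)) :=
    hU.preimage (PiLp.continuous_toLp 2 _)
  obtain ⟨u, hu, hsub⟩ := isOpen_pi_iff'.1 hV x.ofLp hx
  refine MvPolynomial.funext_set u
    (fun i => infinite_of_mem_nhds (x.ofLp i) ((hu i).1.mem_nhds (hu i).2)) fun y hy => ?_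
  rw [map_zero]
  exact h (WithLp.toLp 2 y) (hsub hy)

theorem eq_zero_on_interior_of_integral_eq_zero {T : Set Plane} (hT : IsCompact T) {h : Plane → ℝ}
    (hc : Continuous h) (hpos : ∀ x ∈ T, 0 ≤ h x) (hint : ∫ x in T, h x = 0) :
    ∀ x ∈ interior T, h x = 0 := by
  have h1 : h =ᵐ[volume.restrict T] 0 := by
    refine (setIntegral_eq_zero_iff_of_nonneg_ae ?_
      (hc.continuousOn.integrableOn_compact hT)).1 hint
    exact (ae_restrict_iff' hT.measurableSet).2 (Filter.Eventually.of_forall hpos)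
  have h2 : h =ᵐ[volume.restrict (interior T)] 0 := ae_restrict_of_ae_restrict_of_subset
    interior_subset h1
  exact Measure.eqOn_open_of_ae_eq h2 isOpen_interior hc.continuousOn continuousOn_const

theorem segIntegral_nonneg {φ : Plane → ℝ} (h : ∀ x, 0 ≤ φ x) (a b : Plane) :
    0 ≤ segIntegral φ a b :=
  mul_nonneg dist_nonneg
    (intervalIntegral.integral_nonneg zero_le_one fun _ _ => h _)

theorem edgeInt_mul_self_nonneg (e : Sym2 Plane) (p : Poly) : 0 ≤ edgeInt e (p * p) := by
  induction e using Sym2.ind with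
  | _ a b =>
    refine segIntegral_nonneg (fun x => ?_) a b
    rw [val_mul]; exact mul_self_nonneg _

theorem val_lineMap_eq_zero_of_edgeInt {a b : Plane} (hab : a ≠ b) {p : Poly}
    (h : edgeInt s(a, b) (p * p) = 0) {s : ℝ} (hs : s ∈ Set.Icc (0 : ℝ) 1) :
    val p (AffineMap.lineMap a b s) = 0 := by
  by_contra hne
  have hc : Continuous fun s : ℝ => val (p * p) (AffineMap.lineMap a b s) :=
    (continuous_val _).comp AffineMap.lineMap_continuous
  have : 0 < ∫ s in (0 : ℝ)..1, val (p * p) (AffineMap.lineMap a b s) := by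
    refine intervalIntegral.integral_pos zero_lt_one hc.continuousOn (fun x _ => ?_) ⟨s, hs, ?_⟩
    · rw [val_mul]; exact mul_self_nonneg _
    · rw [val_mul]; exact mul_self_pos.2 hne
  have h' : dist a b * ∫ s in (0 : ℝ)..1, val (p * p) (AffineMap.lineMap a b s) = 0 := h
  exact (mul_pos (dist_pos.2 hab) this).ne' h'

/-- In characteristic zero a coefficient at a nonzero exponent `m` is seen, times the nonzero number
`m j`, in the derivative along some `j`. -/
theorem eq_C_of_pderiv_eq_zero {p : Poly} (h : ∀ j, MvPolynomial.pderiv j p = 0) :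
    p = MvPolynomial.C (MvPolynomial.coeff 0 p) := by
  ext m
  rw [MvPolynomial.coeff_C]
  split_ifs with hm
  · rw [hm]
  · obtain ⟨j, hj⟩ : ∃ j, m j ≠ 0 := by
      by_contra! h0
      exact hm (Finsupp.ext fun j => (h0 j).symm)
    have hm' : m = (m - Finsupp.single j 1) + Finsupp.single j 1 := by
      rw [tsub_add_cancel_of_le]
      simpa using Nat.one_le_iff_ne_zero.2 hj
    have := MvPolynomial.coeff_pderiv (i := j) p (m - Finsupp.single j 1)
    rw [h j, MvPolynomial.coeff_zero, ← hm'] at this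
    refine (mul_eq_zero.1 this.symm).resolve_right ?_
    positivity

theorem mul_pderiv_mem {k : ℕ} {l p : Poly} (hl : l.totalDegree ≤ 1)
    (hp : p ∈ MvPolynomial.restrictTotalDegree (Fin 2) ℝ k) (j : Fin 2) :
    l * MvPolynomial.pderiv j p ∈ MvPolynomial.restrictTotalDegree (Fin 2) ℝ k := by
  rw [MvPolynomial.mem_restrictTotalDegree] at hp ⊢
  by_cases h0 : MvPolynomial.pderiv j p = 0
  -- The zero derivative is split off because for `k = 0` the bound `totalDegree + 1 ≤ k` below
  -- would fail for it.
  · simp [h0]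
  have key : (MvPolynomial.pderiv j p).totalDegree + 1 ≤ k := by
    have hsup : ∀ m ∈ (MvPolynomial.pderiv j p).support, (m.sum fun _ e => e) + 1 ≤ k := by
      intro m hm
      rw [MvPolynomial.mem_support_iff, MvPolynomial.coeff_pderiv] at hm
      have h1 : m + Finsupp.single j 1 ∈ p.support := by
        rw [MvPolynomial.mem_support_iff]
        exact left_ne_zero_of_mul hm
      have h2 := (MvPolynomial.le_totalDegree h1).trans hp
      rwa [Finsupp.sum_add_index' (by simp) (by simp), Finsupp.sum_single_index rfl] at h2
    obtain ⟨m, hm⟩ := MvPolynomial.support_nonempty.2 h0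
    have hk : 1 ≤ k := by have := hsup m hm; omega
    have : (MvPolynomial.pderiv j p).totalDegree ≤ k - 1 :=
      Finset.sup_le fun m hm => by have := hsup m hm; omega
    omega
  have := MvPolynomial.totalDegree_mul l (MvPolynomial.pderiv j p)
  omega

/-! ### Affine coordinates in a triangle -/

theorem openTri_nonempty {a b c : Plane} (h : tdet a b c ≠ 0) : (openTri a b c).Nonempty := by
  refine ⟨triPoint a b c (1 / 3) (1 / 3), ?_⟩
  simp only [openTri, Set.mem_ofPred_eq, tdet_triPoint_left, tdet_triPoint_right]
  rw [mul_div_cancel_right₀ _ h]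
  norm_num

/-- The affine coordinate that vanishes at `a`, `b` and is `1` at `c`, as a polynomial. -/
def baryPoly (a b c : Plane) : Poly :=
  MvPolynomial.C ((b 0 - a 0) / tdet a b c) * (MvPolynomial.X 1 - MvPolynomial.C (a 1)) -
    MvPolynomial.C ((b 1 - a 1) / tdet a b c) * (MvPolynomial.X 0 - MvPolynomial.C (a 0))

theorem val_baryPoly (a b c x : Plane) : val (baryPoly a b c) x = tdet a b x / tdet a b c := by
  simp only [val, baryPoly, map_sub, map_mul, MvPolynomial.eval_C, MvPolynomial.eval_X, tdet]
  ring

theorem totalDegree_linear (c r : ℝ) (i : Fin 2) :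
    (MvPolynomial.C c * (MvPolynomial.X i - MvPolynomial.C r) : Poly).totalDegree ≤ 1 := by
  refine (MvPolynomial.totalDegree_mul _ _).trans ?_
  have := MvPolynomial.totalDegree_sub (MvPolynomial.X i : Poly) (MvPolynomial.C r)
  simp only [MvPolynomial.totalDegree_C, MvPolynomial.totalDegree_X] at this ⊢
  simpa using this

theorem totalDegree_baryPoly (a b c : Plane) : (baryPoly a b c).totalDegree ≤ 1 :=
  (MvPolynomial.totalDegree_sub _ _).trans
    (max_le (totalDegree_linear _ _ _) (totalDegree_linear _ _ _))

theorem tdet_eq_zero_of_mem_edgeSet {a b x : Plane} (hx : x ∈ edgeSet s(a, b)) :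
    tdet a b x = 0 := by
  rw [edgeSet_mk, segment_eq_image_lineMap] at hx
  obtain ⟨s, _, rfl⟩ := hx
  simp [tdet, AffineMap.lineMap_apply]
  ring

theorem tdet_ratio_nonneg {a b c x : Plane} (h : tdet a b c ≠ 0)
    (hx : x ∈ convexHull ℝ ({a, b, c} : Set Plane)) :
    0 ≤ tdet a x c / tdet a b c ∧ 0 ≤ tdet a b x / tdet a b c := by
  obtain ⟨s, t, hs, ht, -, rfl⟩ := mem_convexHull_triple.1 hx
  rw [tdet_triPoint_left, tdet_triPoint_right, mul_div_cancel_right₀ _ h,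
    mul_div_cancel_right₀ _ h]
  exact ⟨hs, ht⟩

/-- A nonzero vector is not normal to two sides of a nondegenerate triangle. -/
theorem eq_zero_of_normal_both {a b c : Plane} (h : tdet a b c ≠ 0) {n : Fin 2 → ℝ}
    (h1 : n ⬝ᵥ (b - a).ofLp = 0) (h2 : n ⬝ᵥ (c - a).ofLp = 0) : n = 0 := by
  simp only [dotProduct, Fin.sum_univ_two, PiLp.sub_apply] at h1 h2
  funext i
  fin_cases i
  · apply mul_left_cancel₀ h
    simp only [tdet, Fin.zero_eta, Pi.zero_apply]
    linear_combination (c 1 - a 1) * h1 - (b 1 - a 1) * h2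
  · apply mul_left_cancel₀ h
    simp only [tdet, Fin.mk_one, Pi.zero_apply]
    linear_combination (b 0 - a 0) * h2 - (c 0 - a 0) * h1

/-- If the normals were parallel, `m` would be normal to two sides of the triangle. -/
theorem cross_normals_ne_zero {a b c : Plane} (h : tdet a b c ≠ 0) {m n : Fin 2 → ℝ}
    (hm : IsUnitNormal m a b) (hn : IsUnitNormal n a c) : m 0 * n 1 - m 1 * n 0 ≠ 0 := by
  intro h0
  have hn1 := hn.1
  have hn2 := hn.2
  have hm1 := hm.1
  have : m ⬝ᵥ (c - a).ofLp = 0 := by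
    simp only [dotProduct, Fin.sum_univ_two, PiLp.sub_apply] at hn1 hn2 ⊢
    linear_combination (n 0 * m 0 + n 1 * m 1) * hn2 -
      (m 0 * (c 0 - a 0) + m 1 * (c 1 - a 1)) * hn1 +
      (n 1 * (c 0 - a 0) - n 0 * (c 1 - a 1)) * h0
  rw [eq_zero_of_normal_both h hm.2 this] at hm1
  simp at hm1

namespace Mesh

variable {Ω : Set Plane} {M : Mesh Ω}

theorem val_eq_zero_of_triInt {τ : M.Tri} {p : Poly} (hpos : ∀ x ∈ M.triSet τ, 0 ≤ val p x)
    (h : M.triInt τ p = 0) :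
    ∀ x ∈ openTri (M.center τ.1) (M.fst τ) (M.snd τ), val p x = 0 := fun x hx =>
  eq_zero_on_interior_of_integral_eq_zero (M.isCompact_triSet τ) (continuous_val p) hpos h x
    (openTri_subset_interior (M.tdet_ne_zero τ) hx)

theorem poly_eq_zero_of_openTri {τ : M.Tri} {p : Poly}
    (h : ∀ x ∈ openTri (M.center τ.1) (M.fst τ) (M.snd τ), val p x = 0) : p = 0 :=
  poly_eq_zero_of_isOpen (isOpen_openTri _ _ _) (openTri_nonempty (M.tdet_ne_zero τ)) h

theorem triInt_nonneg {τ : M.Tri} {p : Poly} (hpos : ∀ x ∈ M.triSet τ, 0 ≤ val p x) :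
    0 ≤ M.triInt τ p :=
  setIntegral_nonneg (M.isCompact_triSet τ).measurableSet hpos

namespace EdgeNormals

variable (N : M.EdgeNormals)

/-! ### Velocities with prescribed fluxes through the dual edges -/

/-- The determinant of the normals on the two dual edges of a triangle. -/
def cross (τ : M.Tri) : ℝ :=
  N.dual τ 0 * N.dual (M.next τ) 1 - N.dual τ 1 * N.dual (M.next τ) 0

theorem cross_ne_zero (τ : M.Tri) : N.cross τ ≠ 0 :=
  cross_normals_ne_zero (M.tdet_ne_zero τ) (N.dual_isUnitNormal τ)
    (N.dual_isUnitNormal (M.next τ))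

/-- The vector with unit flux through the first dual edge of a triangle and none through the
second. -/
def frameFst (τ : M.Tri) : Fin 2 → ℝ :=
  (N.cross τ)⁻¹ • ![N.dual (M.next τ) 1, -N.dual (M.next τ) 0]

/-- The vector with unit flux through the second dual edge of a triangle and none through the
first. -/
def frameSnd (τ : M.Tri) : Fin 2 → ℝ :=
  (N.cross τ)⁻¹ • ![-N.dual τ 1, N.dual τ 0]

/-- The vector field whose fluxes through the two dual edges of the triangle `τ` are `φ τ` and
`ψ τ`. -/
def fluxField (φ ψ : M.Tri → Poly) : M.VectorField :=
  fun τ i => N.frameFst τ i • φ τ + N.frameSnd τ i • ψ τ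

theorem vval_fluxField (φ ψ : M.Tri → Poly) (τ : M.Tri) (x : Plane) :
    vval (N.fluxField φ ψ τ) x =
      val (φ τ) x • N.frameFst τ + val (ψ τ) x • N.frameSnd τ := by
  funext i
  simp only [vval, fluxField, val_add, val_smul, Pi.add_apply, Pi.smul_apply, smul_eq_mul]
  ring

theorem fluxField_dual (φ ψ : M.Tri → Poly) (τ : M.Tri) (x : Plane) :
    vval (N.fluxField φ ψ τ) x ⬝ᵥ N.dual τ = val (φ τ) x := by
  have h := N.cross_ne_zero τ
  rw [vval_fluxField]
  simp only [frameFst, frameSnd, dotProduct, Fin.sum_univ_two, Pi.add_apply, Pi.smul_apply,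
    smul_eq_mul, cons_val_zero, cons_val_one]
  field_simp
  unfold cross; ring

theorem fluxField_dual_next (φ ψ : M.Tri → Poly) (τ : M.Tri) (x : Plane) :
    vval (N.fluxField φ ψ τ) x ⬝ᵥ N.dual (M.next τ) = val (ψ τ) x := by
  have h := N.cross_ne_zero τ
  rw [vval_fluxField]
  simp only [frameFst, frameSnd, dotProduct, Fin.sum_univ_two, Pi.add_apply, Pi.smul_apply,
    smul_eq_mul, cons_val_zero, cons_val_one]
  field_simp
  unfold cross; ring

theorem next_before (e : M.DualEdge) : M.next (M.before e) = e := by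
  obtain ⟨τ, rfl⟩ := M.next.surjective e
  rw [M.before_next]

/-- The edge `e` is the second dual edge of `before e` and the first of `after e`; the fluxes to be
matched are therefore `ψ (before e)` and `φ e`. -/
theorem fluxField_mem {k : ℕ} {φ ψ : M.Tri → Poly}
    (hφ : ∀ τ, φ τ ∈ MvPolynomial.restrictTotalDegree (Fin 2) ℝ k)
    (hψ : ∀ τ, ψ τ ∈ MvPolynomial.restrictTotalDegree (Fin 2) ℝ k)
    (h : ∀ e, ∀ x ∈ edgeSet (M.dualSym e), val (ψ (M.before e)) x = val (φ e) x) :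
    N.fluxField φ ψ ∈ N.velocitySpace k := by
  refine ⟨fun τ i => Submodule.add_mem _ (Submodule.smul_mem _ _ (hφ τ))
    (Submodule.smul_mem _ _ (hψ τ)), fun e x hx => ?_⟩
  have h1 := N.fluxField_dual_next φ ψ (M.before e) x
  rw [next_before] at h1
  rw [h1, after, fluxField_dual, h e x hx]

/-! ### A pressure in the kernel of `b_h` is cellwise constant -/

/-- The test velocity is chosen so that `v · ∇q = l d² + l' d'²` with `l`, `l'` positive inside the
triangle, while the factors `l`, `l'` annihilate the terms on dual edges. Its degree is admissible
because differentiation makes room for the linear factor. -/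
theorem pderiv_eq_zero_of_formb {k : ℕ} {q : M.ScalarField} (hq : q ∈ M.pressureSpace k)
    (h : ∀ v ∈ N.velocitySpace k, N.formb v q = 0) (τ : M.Tri) (j : Fin 2) :
    MvPolynomial.pderiv j (q τ) = 0 := by
  -- `l` and `l'` are the barycentric coordinates that vanish on the first and on the second dual
  -- edge; `d` and `d'` are the derivatives of `q` along the two frame vectors.
  set l : M.Tri → Poly := fun τ => baryPoly (M.center τ.1) (M.fst τ) (M.snd τ) with hl
  set l' : M.Tri → Poly := fun τ => baryPoly (M.center τ.1) (M.snd τ) (M.fst τ) with hl'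
  set d : M.Tri → Poly := fun τ => ∑ j, N.frameFst τ j • MvPolynomial.pderiv j (q τ) with hd
  set d' : M.Tri → Poly := fun τ => ∑ j, N.frameSnd τ j • MvPolynomial.pderiv j (q τ) with hd'
  set v := N.fluxField (fun τ => l τ * d τ) (fun τ => l' τ * d' τ) with hv
  have hl0 : ∀ e, ∀ x ∈ edgeSet (M.dualSym e), val (l e) x = 0 := by
    intro e x hx
    rw [hl, val_baryPoly]
    exact div_eq_zero_iff.2 (Or.inl (tdet_eq_zero_of_mem_edgeSet hx))
  have hl'0 : ∀ e, ∀ x ∈ edgeSet (M.dualSym e), val (l' (M.before e)) x = 0 := by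
    intro e x hx
    simp only [hl']
    rw [val_baryPoly, M.snd_before]
    exact div_eq_zero_iff.2 (Or.inl (tdet_eq_zero_of_mem_edgeSet hx))
  have hmem : v ∈ N.velocitySpace k := by
    refine N.fluxField_mem (fun τ => ?_) (fun τ => ?_) fun e x hx => ?_
    · rw [hd, Finset.mul_sum]
      refine Submodule.sum_mem _ fun j _ => ?_
      rw [mul_smul_comm]
      exact Submodule.smul_mem _ _ (mul_pderiv_mem (totalDegree_baryPoly _ _ _) (hq.1 τ) j)
    · rw [hd', Finset.mul_sum]
      refine Submodule.sum_mem _ fun j _ => ?_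
      rw [mul_smul_comm]
      exact Submodule.smul_mem _ _ (mul_pderiv_mem (totalDegree_baryPoly _ _ _) (hq.1 τ) j)
    · rw [val_mul, val_mul, hl0 e x hx, hl'0 e x hx, zero_mul, zero_mul]
  have hform := h v hmem
  have hedge : ∀ e, edgeInt (M.dualSym e)
      ((v (M.after e) ⬝ᵥ CV (N.dual e)) * N.jumpDual q e) = 0 := by
    intro e
    rw [← map_zero (edgeInt (M.dualSym e))]
    refine edgeInt_congr fun x hx => ?_
    rw [val_mul, val_dotProduct, vval_CV, hv, after, fluxField_dual, val_mul, hl0 e x hx]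
    simp [val]
  rw [formb_eq, Finset.sum_eq_zero fun e _ => hedge e, sub_zero] at hform
  have hval : ∀ τ x, val (v τ ⬝ᵥ grad (q τ)) x =
      val (l τ) x * (val (d τ) x) ^ 2 + val (l' τ) x * (val (d' τ) x) ^ 2 := by
    intro τ x
    rw [val_dotProduct, hv, vval_fluxField]
    simp only [hd, hd', vval, grad, dotProduct, Fin.sum_univ_two, val_add, val_smul, val_mul,
      Pi.add_apply, Pi.smul_apply, smul_eq_mul]
    ring
  have hlval : ∀ τ x, val (l τ) x =
      tdet (M.center τ.1) (M.fst τ) x / tdet (M.center τ.1) (M.fst τ) (M.snd τ) :=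
    fun τ x => val_baryPoly _ _ _ _
  have hl'val : ∀ τ x, val (l' τ) x =
      tdet (M.center τ.1) x (M.snd τ) / tdet (M.center τ.1) (M.fst τ) (M.snd τ) := by
    intro τ x
    simp only [hl', val_baryPoly]
    rw [tdet_swap _ x, tdet_swap _ (M.fst τ), neg_div_neg_eq]
  have hpos : ∀ τ, ∀ x ∈ M.triSet τ, 0 ≤ val (v τ ⬝ᵥ grad (q τ)) x := by
    intro τ x hx
    have := tdet_ratio_nonneg (M.tdet_ne_zero τ) hx
    rw [hval, hlval, hl'val]
    exact add_nonneg (mul_nonneg this.2 (sq_nonneg _)) (mul_nonneg this.1 (sq_nonneg _))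
  have hzero := (Finset.sum_eq_zero_iff_of_nonneg fun τ _ => triInt_nonneg (hpos τ)).1 hform τ
    (Finset.mem_univ τ)
  have hz := val_eq_zero_of_triInt (hpos τ) hzero
  refine poly_eq_zero_of_openTri (τ := τ) fun x hx => ?_
  have hx0 := hz x hx
  rw [hval, hlval, hl'val] at hx0
  obtain ⟨p1, p2, -⟩ := hx
  have e1 : val (d τ) x = 0 := by
    have := mul_nonneg p2.le (sq_nonneg (val (d τ) x))
    have := mul_nonneg p1.le (sq_nonneg (val (d' τ) x))
    exact pow_eq_zero_iff (two_ne_zero) |>.1 ((mul_eq_zero.1 (by linarith :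
      tdet (M.center τ.1) (M.fst τ) x / tdet (M.center τ.1) (M.fst τ) (M.snd τ) *
        (val (d τ) x) ^ 2 = 0)).resolve_left p2.ne')
  have e2 : val (d' τ) x = 0 := by
    rw [e1] at hx0
    exact pow_eq_zero_iff (two_ne_zero) |>.1 ((mul_eq_zero.1 (by linarith :
      tdet (M.center τ.1) x (M.snd τ) / tdet (M.center τ.1) (M.fst τ) (M.snd τ) *
        (val (d' τ) x) ^ 2 = 0)).resolve_left p1.ne')
  -- The frame vectors are the basis dual to the two normals, so the derivatives along them
  -- determine the gradient.
  have hc := N.cross_ne_zero τ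
  simp only [hd, hd', Fin.sum_univ_two, val_add, val_smul, frameFst, frameSnd, Pi.smul_apply,
    smul_eq_mul, cons_val_zero, cons_val_one] at e1 e2
  have hX : N.cross τ * (N.cross τ)⁻¹ = 1 := mul_inv_cancel₀ hc
  have hcr : N.cross τ =
    N.dual τ 0 * N.dual (M.next τ) 1 - N.dual τ 1 * N.dual (M.next τ) 0 := rfl
  fin_cases j
  · simp only [Fin.zero_eta]
    linear_combination N.dual τ 0 * e1 + N.dual (M.next τ) 0 * e2 -
      val (MvPolynomial.pderiv 0 (q τ)) x * hX +
      val (MvPolynomial.pderiv 0 (q τ)) x * (N.cross τ)⁻¹ * hcr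
  · simp only [Fin.mk_one]
    linear_combination N.dual τ 1 * e1 + N.dual (M.next τ) 1 * e2 -
      val (MvPolynomial.pderiv 1 (q τ)) x * hX +
      val (MvPolynomial.pderiv 1 (q τ)) x * (N.cross τ)⁻¹ * hcr

/-- Gradients of constants vanish, so a velocity whose flux through each dual edge is the jump
reduces the form to minus the sum of the integrals of the squared jumps. -/
theorem before_eq_after_of_formb {k : ℕ} {c : M.Tri → ℝ}
    (h : ∀ v ∈ N.velocitySpace k, N.formb v (fun τ => MvPolynomial.C (c τ)) = 0)
    (e : M.DualEdge) : c (M.before e) = c (M.after e) := by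
  have hjump : ∀ e, N.jumpDual (fun τ => (MvPolynomial.C (c τ) : Poly)) e =
      MvPolynomial.C (N.jumpDual c e) := by
    intro e
    simp [jumpDual, MvPolynomial.smul_eq_C_mul]
  have hdeg : ∀ r : ℝ, (MvPolynomial.C r : Poly) ∈
      MvPolynomial.restrictTotalDegree (Fin 2) ℝ k := fun r => by
    rw [MvPolynomial.mem_restrictTotalDegree]; simp
  set v := N.fluxField (fun e => MvPolynomial.C (N.jumpDual c e))
    (fun τ => MvPolynomial.C (N.jumpDual c (M.next τ))) with hv
  have hform := h v (N.fluxField_mem (fun τ => hdeg _) (fun τ => hdeg _)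
    fun e x _ => by rw [next_before])
  have hedge : ∀ e, edgeInt (M.dualSym e) ((v (M.after e) ⬝ᵥ CV (N.dual e)) *
      N.jumpDual (fun τ => (MvPolynomial.C (c τ) : Poly)) e) =
      edgeInt (M.dualSym e) (MvPolynomial.C (N.jumpDual c e) * MvPolynomial.C (N.jumpDual c e)) := by
    intro e
    refine edgeInt_congr fun x _ => ?_
    rw [hjump, val_mul, val_mul, val_dotProduct, vval_CV, hv, after, fluxField_dual]
  rw [formb_eq, Finset.sum_congr rfl fun e _ => hedge e,
    Finset.sum_eq_zero (s := Finset.univ) (f := fun τ => M.triInt τ _), zero_sub,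
    neg_eq_zero] at hform
  · have h0 := (Finset.sum_eq_zero_iff_of_nonneg fun e _ =>
      edgeInt_mul_self_nonneg (M.dualSym e) _).1 hform e (Finset.mem_univ e)
    have h1 := val_lineMap_eq_zero_of_edgeInt (M.center_ne_vertex e) h0 (s := 0) (by simp)
    rw [val_C, jumpDual] at h1
    simp only [smul_eq_mul] at h1
    -- The two signs are opposite and nonzero, so a vanishing jump means equal values.
    have hs := N.sign_before_add_sign_after e
    have hq := N.sign_after_sq e
    have hne : M.normalAfter e ⬝ᵥ N.dual e ≠ 0 := left_ne_zero_of_mul_eq_one hq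
    apply mul_left_cancel₀ hne
    linear_combination -h1 + c (M.before e) * hs
  · intro τ _
    simp [grad, dotProduct]

end EdgeNormals

end Mesh

/-! ### Connectedness of a domain without finitely many points -/

/-- Polar coordinates: the image of an interval times the unit circle. -/
theorem isPreconnected_ball_diff_singleton (x : Plane) (r : ℝ) :
    IsPreconnected (Metric.ball x r \ {x}) := by
  have hrank : 1 < Module.rank ℝ Plane := by
    rw [← Module.finrank_eq_rank, finrank_euclideanSpace_fin]; norm_num
  have h := ((isPreconnected_Ioo (a := (0 : ℝ)) (b := r)).prod
    (isPreconnected_sphere hrank (0 : Plane) 1)).image (fun y : ℝ × Plane => x + y.1 • y.2)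
    (by fun_prop)
  convert! h using 1
  ext y
  simp only [Set.mem_sdiff, Metric.mem_ball, Set.mem_singleton_iff, Set.mem_image, Set.mem_prod,
    Set.mem_Ioo, mem_sphere_zero_iff_norm, Prod.exists]
  constructor
  · rintro ⟨h1, h2⟩
    have hpos : 0 < ‖y - x‖ := norm_pos_iff.2 (sub_ne_zero.2 h2)
    refine ⟨‖y - x‖, ‖y - x‖⁻¹ • (y - x), ⟨⟨hpos, by rwa [← dist_eq_norm]⟩, ?_⟩, ?_⟩
    · rw [norm_smul, norm_inv, norm_norm, inv_mul_cancel₀ hpos.ne']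
    · rw [smul_smul, mul_inv_cancel₀ hpos.ne', one_smul, add_sub_cancel]
  · rintro ⟨t, z, ⟨⟨h1, h2⟩, hz⟩, rfl⟩
    have hn : ‖t • z‖ = t := by rw [norm_smul, hz, mul_one, Real.norm_of_nonneg h1.le]
    refine ⟨by rw [dist_eq_norm, add_sub_cancel_left, hn]; exact h2, fun h => ?_⟩
    rw [add_eq_left] at h
    rw [h, norm_zero] at hn
    exact h1.ne hn

/-- In a separation of `U \ {x}` the connected punctured ball around `x` lies in one part; adding
the whole ball to that part would separate `U`, which `key` refutes. -/
theorem isPreconnected_diff_singleton {U : Set Plane} (hU : IsOpen U) (hc : IsPreconnected U)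
    (x : Plane) : IsPreconnected (U \ {x}) := by
  by_cases hx : x ∈ U
  swap
  · rwa [Set.sdiff_singleton_eq_self hx]
  have hS : IsOpen (U \ {x}) := hU.sdiff isClosed_singleton
  obtain ⟨r, hr, hball⟩ := Metric.isOpen_iff.1 hU x hx
  have key : ∀ u v : Set Plane, IsOpen u → IsOpen v → Disjoint u v → v ⊆ U \ {x} →
      U \ {x} ⊆ u ∪ v → v.Nonempty → ¬ Metric.ball x r \ {x} ⊆ u := by
    intro u v hu hv huv hvS hcov hvne hsub
    have hne : (U ∩ v).Nonempty := by
      obtain ⟨y, hy⟩ := hvne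
      exact ⟨y, (hvS hy).1, hy⟩
    obtain ⟨y, -, hy1, hy2⟩ := hc (u ∪ Metric.ball x r) v (hu.union Metric.isOpen_ball) hv
      (fun y hy => by
        by_cases hyx : y = x
        · subst hyx; exact Or.inl (Or.inr (Metric.mem_ball_self hr))
        · rcases hcov ⟨hy, hyx⟩ with h | h
          · exact Or.inl (Or.inl h)
          · exact Or.inr h)
      ⟨x, hx, Or.inr (Metric.mem_ball_self hr)⟩ hne
    rcases hy1 with hy1 | hy1
    · exact huv.le_bot ⟨hy1, hy2⟩
    · exact huv.le_bot ⟨hsub ⟨hy1, (hvS hy2).2⟩, hy2⟩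
  intro u v hu hv hcov hne1 hne2
  by_contra hemp
  rw [Set.not_nonempty_iff_eq_empty] at hemp
  have hdis : Disjoint ((U \ {x}) ∩ u) ((U \ {x}) ∩ v) := by
    rw [Set.disjoint_iff_inter_eq_empty, ← hemp]
    ext y; simp only [Set.mem_inter_iff]; tauto
  have hcov' : U \ {x} ⊆ ((U \ {x}) ∩ u) ∪ ((U \ {x}) ∩ v) := by
    rw [← Set.inter_union_distrib_left]
    exact Set.subset_inter subset_rfl hcov
  have hsub : Metric.ball x r \ {x} ⊆ U \ {x} := Set.sdiff_subset_sdiff_left hball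
  rcases (isPreconnected_ball_diff_singleton x r).subset_or_subset (hS.inter hu) (hS.inter hv) hdis
    (hsub.trans hcov') with h | h
  · exact key _ _ (hS.inter hu) (hS.inter hv) hdis Set.inter_subset_left hcov' hne2 h
  · refine key _ _ (hS.inter hv) (hS.inter hu) hdis.symm Set.inter_subset_left ?_ hne1 h
    rwa [Set.union_comm]

theorem isPreconnected_diff_finite {U V : Set Plane} (hU : IsOpen U) (hc : IsPreconnected U)
    (hV : V.Finite) : IsPreconnected (U \ V) := by
  induction V, hV using Set.Finite.induction_on with
  | empty => simpa using hc
  | @insert x V _ hV ih =>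
    rw [show U \ insert x V = (U \ V) \ {x} by
      ext y; simp only [Set.mem_sdiff, Set.mem_insert_iff, Set.mem_singleton_iff]; tauto]
    exact isPreconnected_diff_singleton (hU.sdiff hV.isClosed) ih x

theorem eq_of_finRotate_eq {X : Type*} {n : ℕ} {h : Fin n → X} (hr : ∀ i, h (finRotate n i) = h i)
    (i j : Fin n) : h i = h j := by
  cases n with
  | zero => exact i.elim0
  | succ n =>
    have key : ∀ i, h i = h 0 := by
      intro i
      induction i using Fin.induction with
      | zero => rfl
      | succ i ih =>
        rw [← ih, ← hr i.castSucc, finRotate_apply, Fin.coeSucc_eq_succ]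
    rw [key i, key j]

namespace Mesh

variable {Ω : Set Plane} (M : Mesh Ω)

theorem interior_triSet_nonempty (τ : M.Tri) : (interior (M.triSet τ)).Nonempty :=
  interior_triangle_nonempty (M.tdet_ne_zero τ)

/-- The triangles are known to lie only in `closure Ω`; the absence of slits brings their interiors
into `Ω`. -/
theorem interior_triSet_subset (hΩ : IsPolygonalDomain Ω) (τ : M.Tri) :
    interior (M.triSet τ) ⊆ Ω := by
  have h : M.triSet τ ⊆ closure Ω :=
    M.cover ▸ Set.subset_iUnion (fun τ : M.Tri => M.triSet τ) τ
  exact (interior_mono h).trans hΩ.interior_closure.subset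

/-- The interior point of a cell lies in no triangle of another cell. -/
theorem eq_of_center_mem {c : M.Cell} {τ : M.Tri} (h : M.center c ∈ M.triSet τ) : τ.1 = c := by
  by_contra hne
  set S : Set Plane := ⋃ i, M.triSet ⟨c, i⟩ with hS
  -- Triangles are closures of their interiors. Near the centre there are thus interior points of
  -- `τ` inside the cell `c`, and near those, interior points of a triangle of `c` as well, against
  -- disjointness.
  have h1 := triangle_subset_closure_interior (M.tdet_ne_zero τ) h
  have h2 : M.center c ∈ interior S := M.center_mem_interior c
  obtain ⟨y, hy1, hy2⟩ := mem_closure_iff.1 h1 _ isOpen_interior h2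
  obtain ⟨i, hi⟩ := Set.mem_iUnion.1 (interior_subset hy1)
  have h3 := triangle_subset_closure_interior (M.tdet_ne_zero ⟨c, i⟩) hi
  obtain ⟨z, hz1, hz2⟩ := mem_closure_iff.1 h3 _ isOpen_interior hy2
  have hd := M.disjoint_interior τ ⟨c, i⟩ (fun h => hne (congrArg Sigma.fst h))
  exact hd.le_bot ⟨hz1, hz2⟩

/-- The set of all vertices of the triangles. -/
def vertices : Set Plane := ⋃ τ : M.Tri, {M.center τ.1, M.fst τ, M.snd τ}

theorem finite_vertices : M.vertices.Finite :=
  Set.finite_iUnion fun τ => Set.toFinite {M.center τ.1, M.fst τ, M.snd τ}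

/-- Triangles of different cells meet, away from the vertices, only in common primal edges. -/
theorem primalEdge_eq_of_mem {τ τ' : M.Tri} (hne : τ.1 ≠ τ'.1) {x : Plane} (hx : x ∈ M.triSet τ)
    (hx' : x ∈ M.triSet τ') (hv : x ∉ M.vertices) :
    M.primalEdge τ = M.primalEdge τ' ∧ x ∈ edgeSet (M.primalEdge τ).1 := by
  have hmem : x ∈ convexHull ℝ (({M.center τ.1, M.fst τ, M.snd τ} : Set Plane) ∩
      {M.center τ'.1, M.fst τ', M.snd τ'}) :=
    M.conforming τ τ' (fun h => hne (congrArg Sigma.fst h)) ⟨hx, hx'⟩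
  -- By conformity `x` is in the hull of the common vertices. No centre is among them, so they are
  -- endpoints of the primal edges; a single one would make `x` a vertex, so both are common.
  have hc : M.center τ.1 ∉ ({M.center τ'.1, M.fst τ', M.snd τ'} : Set Plane) := fun h =>
    hne (M.eq_of_center_mem (τ := τ') (subset_convexHull ℝ _ h)).symm
  have hc' : M.center τ'.1 ∉ ({M.center τ.1, M.fst τ, M.snd τ} : Set Plane) := fun h =>
    hne (M.eq_of_center_mem (τ := τ) (subset_convexHull ℝ _ h))
  have hsub : ({M.center τ.1, M.fst τ, M.snd τ} : Set Plane) ∩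
      {M.center τ'.1, M.fst τ', M.snd τ'} ⊆ {M.fst τ, M.snd τ} := by
    rintro y ⟨hy | hy, hy'⟩
    · exact absurd (hy ▸ hy') hc
    · exact hy
  have hvert : ∀ y ∈ ({M.center τ.1, M.fst τ, M.snd τ} : Set Plane), x ≠ y := by
    rintro y hy rfl
    exact hv (Set.mem_iUnion.2 ⟨τ, hy⟩)
  have hfst : M.fst τ ∈ ({M.fst τ', M.snd τ'} : Set Plane) := by
    by_contra hf
    have : ({M.center τ.1, M.fst τ, M.snd τ} : Set Plane) ∩
        {M.center τ'.1, M.fst τ', M.snd τ'} ⊆ {M.snd τ} := by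
      intro y hy
      rcases hsub hy with rfl | h
      · rcases hy.2 with h | h
        · exact absurd (h ▸ hy.1) hc'
        · exact absurd h hf
      · exact h
    have := convexHull_mono this hmem
    rw [convexHull_singleton] at this
    exact hvert _ (by simp) this
  have hsnd : M.snd τ ∈ ({M.fst τ', M.snd τ'} : Set Plane) := by
    by_contra hf
    have : ({M.center τ.1, M.fst τ, M.snd τ} : Set Plane) ∩
        {M.center τ'.1, M.fst τ', M.snd τ'} ⊆ {M.fst τ} := by
      intro y hy
      rcases hsub hy with h | h
      · exact h
      · rw [Set.mem_singleton_iff] at h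
        subst h
        rcases hy.2 with h | h
        · exact absurd (h ▸ hy.1) hc'
        · exact absurd h hf
    have := convexHull_mono this hmem
    rw [convexHull_singleton] at this
    exact hvert _ (by simp) this
  constructor
  · apply Subtype.ext
    change s(M.fst τ, M.snd τ) = s(M.fst τ', M.snd τ')
    have hfs := M.fst_ne_snd τ
    rw [Sym2.eq_iff]
    rcases hfst with h1 | h1 <;> rcases hsnd with h2 | h2
    · exact absurd (h1.trans h2.symm) hfs
    · exact Or.inl ⟨h1, h2⟩
    · exact Or.inr ⟨h1, h2⟩
    · exact absurd (h1.trans h2.symm) hfs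
  · have := convexHull_mono hsub hmem
    rw [convexHull_pair] at this
    change x ∈ edgeSet s(M.fst τ, M.snd τ)
    rwa [edgeSet_mk]

/-- A cellwise constant that does not jump over the interior primal edges is constant. -/
theorem eq_of_no_jumps (hΩ : IsPolygonalDomain Ω) {X : Type*} {c : M.Tri → X}
    (hdual : ∀ e : M.DualEdge, c (M.before e) = c (M.after e))
    (hprimal : ∀ τ τ', M.primalEdge τ = M.primalEdge τ' → M.IsInteriorEdge (M.primalEdge τ) →
      c τ = c τ') (τ τ' : M.Tri) : c τ = c τ' := by
  have hcell : ∀ τ τ' : M.Tri, τ.1 = τ'.1 → c τ = c τ' := by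
    rintro ⟨a, i⟩ ⟨b, j⟩ (rfl : a = b)
    refine eq_of_finRotate_eq (h := fun i => c ⟨a, i⟩) (fun i => ?_) i j
    have := hdual (M.next ⟨a, i⟩)
    rw [M.before_next] at this
    exact this.symm
  have hmeet : ∀ τ τ' x, x ∈ Ω \ M.vertices → x ∈ M.triSet τ → x ∈ M.triSet τ' → c τ = c τ' := by
    intro τ τ' x hx h h'
    by_cases hne : τ.1 = τ'.1
    · exact hcell _ _ hne
    · obtain ⟨h1, h2⟩ := M.primalEdge_eq_of_mem hne h h' hx.2
      -- The common edge is interior: it contains `x`, and the open set `Ω` misses its frontier.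
      refine hprimal _ _ h1 fun hsub => ?_
      have := hsub h2
      rw [hΩ.isOpen.frontier_eq] at this
      exact this.2 hx.1
  have hcl : ∀ P : M.Tri → Prop, IsClosed (⋃ τ : {τ // P τ}, M.triSet τ.1) := fun P =>
    isClosed_iUnion_of_finite fun τ => (M.isCompact_triSet τ.1).isClosed
  have hpre := isPreconnected_diff_finite hΩ.isOpen hΩ.isConnected.isPreconnected M.finite_vertices
  have hpt : ∀ τ, ∃ x ∈ Ω \ M.vertices, x ∈ M.triSet τ := by
    intro τ
    obtain ⟨y, hy⟩ := M.interior_triSet_nonempty τ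
    have hinf : (interior (M.triSet τ)).Infinite :=
      infinite_of_mem_nhds y (isOpen_interior.mem_nhds hy)
    obtain ⟨x, hx, hxv⟩ := hinf.exists_notMem_finite M.finite_vertices
    exact ⟨x, ⟨M.interior_triSet_subset hΩ τ hx, hxv⟩, interior_subset hx⟩
  by_contra hne
  obtain ⟨x, hx, hxτ⟩ := hpt τ
  obtain ⟨x', hx', hxτ'⟩ := hpt τ'
  -- The triangles with the value `c τ` and those with other values form two closed sets covering
  -- `Ω` without the vertices. By connectedness they meet there, against `hmeet`.
  obtain ⟨y, hy, hy1, hy2⟩ := isPreconnected_closed_iff.1 hpre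
    (⋃ σ : {σ // c σ = c τ}, M.triSet σ.1) (⋃ σ : {σ // c σ ≠ c τ}, M.triSet σ.1)
    (hcl _) (hcl _)
    (fun z hz => by
      have hzc : z ∈ closure Ω := subset_closure hz.1
      rw [← M.cover] at hzc
      obtain ⟨σ, hσ⟩ := Set.mem_iUnion.1 hzc
      by_cases h : c σ = c τ
      · exact Or.inl (Set.mem_iUnion.2 ⟨⟨σ, h⟩, hσ⟩)
      · exact Or.inr (Set.mem_iUnion.2 ⟨⟨σ, h⟩, hσ⟩))
    ⟨x, hx, Set.mem_iUnion.2 ⟨⟨τ, rfl⟩, hxτ⟩⟩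
    ⟨x', hx', Set.mem_iUnion.2 ⟨⟨τ', Ne.symm hne⟩, hxτ'⟩⟩
  obtain ⟨⟨σ, hσ⟩, hyσ⟩ := Set.mem_iUnion.1 hy1
  obtain ⟨⟨σ', hσ'⟩, hyσ'⟩ := Set.mem_iUnion.1 hy2
  exact hσ' ((hmeet σ' σ y hy hyσ' hyσ).trans hσ)

namespace EdgeNormals

variable {M} (N : M.EdgeNormals)

/-- Injectivity of `q ↦ b_h(·, q)` on the pressure space. -/
theorem pressure_eq_zero_of_formb (hΩ : IsPolygonalDomain Ω) {k : ℕ} {q : M.ScalarField}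
    (hq : q ∈ M.pressureSpace k) (h : ∀ v ∈ N.velocitySpace k, N.formb v q = 0) : q = 0 := by
  set c : M.Tri → ℝ := fun τ => MvPolynomial.coeff 0 (q τ) with hc
  have hqc : q = fun τ => MvPolynomial.C (c τ) := funext fun τ =>
    eq_C_of_pderiv_eq_zero fun j => N.pderiv_eq_zero_of_formb hq h τ j
  rw [hqc] at h
  have hconst := M.eq_of_no_jumps hΩ (c := c) (N.before_eq_after_of_formb h)
    (fun τ τ' hτ hint => by
      have := hq.2.1 _ hint τ τ' rfl hτ.symm (M.fst τ) (by
        change M.fst τ ∈ edgeSet s(M.fst τ, M.snd τ)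
        rw [edgeSet_mk]; exact left_mem_segment ℝ _ _)
      rw [hqc, val_C, val_C] at this
      exact this)
  funext τ
  have hint := hq.2.2
  rw [hqc] at hint ⊢
  simp only [val_C, integral, setIntegral_const, smul_eq_mul, hconst _ τ] at hint
  rw [← Finset.sum_mul] at hint
  -- The zero mean is now the constant times the total area.
  have hpos : 0 < ∑ σ : M.Tri, (volume : Measure Plane).real (M.triSet σ) := by
    refine Finset.sum_pos (fun σ _ => ?_) ⟨τ, Finset.mem_univ τ⟩
    rw [measureReal_def]
    refine ENNReal.toReal_pos ?_ (M.isCompact_triSet σ).measure_lt_top.ne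
    exact (Measure.measure_pos_of_nonempty_interior volume (M.interior_triSet_nonempty σ)).ne'
  simp [(mul_eq_zero.1 hint).resolve_left hpos.ne']

end EdgeNormals

end Mesh

namespace Mesh

namespace EdgeNormals

variable {Ω : Set Plane} {M : Mesh Ω} (N : M.EdgeNormals)

/-! ### Injectivity of `w ↦ T_h^*(w, ·)` -/

theorem extend_mem {k : ℕ} (a b : Plane) {r : Polynomial ℝ} (hr : r ∈ Polynomial.degreeLE ℝ k) :
    extend a b r ∈ MvPolynomial.restrictTotalDegree (Fin 2) ℝ k := by
  rw [MvPolynomial.mem_restrictTotalDegree, extend, Polynomial.aeval_eq_sum_range]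
  have hl : (∑ i, MvPolynomial.C ((b i - a i) / ‖b - a‖ ^ 2) *
      (MvPolynomial.X i - MvPolynomial.C (a i)) : Poly).totalDegree ≤ 1 :=
    MvPolynomial.totalDegree_finsetSum_le fun i _ => totalDegree_linear _ _ _
  refine MvPolynomial.totalDegree_finsetSum_le fun i hi => ?_
  refine (MvPolynomial.totalDegree_smul_le _ _).trans ((MvPolynomial.totalDegree_pow _ _).trans ?_)
  have h1 : i ≤ r.natDegree := Nat.lt_succ_iff.1 (Finset.mem_range.1 hi)
  have h2 : r.natDegree ≤ k := Polynomial.natDegree_le_of_degree_le (Polynomial.mem_degreeLE.1 hr)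
  calc _ ≤ i * 1 := Nat.mul_le_mul_left i hl
    _ ≤ k := by omega

theorem edgeParam_lineMap {a b : Plane} (hab : a ≠ b) (s : ℝ) :
    edgeParam a b (AffineMap.lineMap a b s) = s := by
  have h : ‖b - a‖ ≠ 0 := norm_ne_zero_iff.2 (sub_ne_zero.2 hab.symm)
  rw [edgeParam, AffineMap.lineMap_apply, vsub_eq_sub, vadd_eq_add, add_sub_cancel_right,
    real_inner_smul_left, real_inner_self_eq_norm_sq]
  field_simp

/-- The direction of the primal edge of a triangle. -/
def primalDir (τ : M.Tri) : Fin 2 → ℝ := (M.snd τ - M.fst τ).ofLp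

/-- Otherwise the normal of the first dual edge would also be normal to the second, hence to two
sides of the triangle. -/
theorem primalDir_dotProduct_dual_ne_zero (τ : M.Tri) : primalDir τ ⬝ᵥ N.dual τ ≠ 0 := by
  intro h
  have hn := N.dual_isUnitNormal τ
  have h1 : N.dual τ ⬝ᵥ (M.fst τ - M.center τ.1).ofLp = 0 := hn.2
  have h2 : N.dual τ ⬝ᵥ (M.snd τ - M.center τ.1).ofLp = 0 := by
    simp only [primalDir, dotProduct, Fin.sum_univ_two, PiLp.sub_apply] at h h1 ⊢
    linear_combination h + h1
  have h3 := hn.1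
  rw [eq_zero_of_normal_both (M.tdet_ne_zero τ) h1 h2] at h3
  simp at h3

/-- A tensor field without flux through the primal edges, and with tangential flux `φ τ` (up to a
factor) only through the first dual edge of the triangle `τ`. -/
def dualTensor (φ : M.Tri → Poly) : M.TensorField :=
  fun τ => Matrix.of fun i j => (N.dual (M.next τ) i * primalDir τ j) • φ τ

theorem mval_dualTensor_mulVec (φ : M.Tri → Poly) (τ : M.Tri) (x : Plane) (m : Fin 2 → ℝ) :
    mval (N.dualTensor φ τ) x *ᵥ m =
      (val (φ τ) x * (primalDir τ ⬝ᵥ m)) • N.dual (M.next τ) := by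
  funext i
  simp only [mval, dualTensor, mulVec, dotProduct, Fin.sum_univ_two, of_apply, val_smul,
    Pi.smul_apply, smul_eq_mul]
  ring

/-- The rows are parallel to the primal edge, so the flux through it is zero from either side. -/
theorem dualTensor_mem {k : ℕ} {φ : M.Tri → Poly}
    (hφ : ∀ τ, φ τ ∈ MvPolynomial.restrictTotalDegree (Fin 2) ℝ k) :
    N.dualTensor φ ∈ N.gradientSpace k := by
  refine ⟨fun τ i j => Submodule.smul_mem _ _ (hφ τ), ?_⟩
  have h0 : ∀ τ x, mval (N.dualTensor φ τ) x *ᵥ N.primal (M.primalEdge τ) = 0 := by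
    intro τ x
    rw [mval_dualTensor_mulVec, primalDir, dotProduct_comm, (N.primal_isUnitNormal τ).2]
    simp
  intro e _ τ τ' hτ hτ' x _
  have h1 := h0 τ x
  have h2 := h0 τ' x
  rw [hτ] at h1
  rw [hτ'] at h2
  rw [h1, h2]

/-- On the edge `e` the tensor from `before e` has flux along `N.dual e`, orthogonal to `w`; only
`after e` contributes, and `φ` makes its contribution a square. -/
theorem trace_eq_zero_of_formTstar {k : ℕ} {w : M.EdgeField} (hw : w ∈ N.traceSpace k)
    (h : ∀ G ∈ N.gradientSpace k, N.formTstar w G = 0) : w = 0 := by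
  -- `κ` is the factor that the jump and the scalar product with the normal produce; put into `φ`,
  -- it makes the integrand exactly `φ²`, without a sign to discuss.
  set κ : M.Tri → ℝ := fun τ => (M.normalAfter τ ⬝ᵥ N.dual τ) * (primalDir τ ⬝ᵥ N.dual τ) with hκ
  set φ : M.Tri → Poly := fun τ => κ τ • (CV (N.dual (M.next τ)) ⬝ᵥ extendField w τ) with hφ
  have hmem : N.dualTensor φ ∈ N.gradientSpace k := by
    refine N.dualTensor_mem fun τ => Submodule.smul_mem _ _ (Submodule.sum_mem _ fun i _ => ?_)
    rw [CV, ← MvPolynomial.smul_eq_C_mul]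
    exact Submodule.smul_mem _ _ (extend_mem _ _ (hw.1 τ i))
  have hform := h _ hmem
  have hval : ∀ τ x, val (φ τ) x = κ τ * (N.dual (M.next τ) ⬝ᵥ M.eval w τ x) := by
    intro τ x
    simp only [hφ, val_smul, val_dotProduct, vval_CV, vval_extendField]
  have hedge : ∀ e, edgeInt (M.dualSym e) (extendField w e ⬝ᵥ
      N.jumpDual (fun τ => N.dualTensor φ τ *ᵥ CV (N.dual e)) e) =
      edgeInt (M.dualSym e) (φ e * φ e) := by
    intro e
    refine edgeInt_congr fun x hx => ?_
    have hn := hw.2 e x hx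
    have hnext : M.next (M.before e) = e := next_before e
    rw [val_dotProduct, vval_extendField, jumpDual, vval_add, vval_smul, vval_smul, vval_mulVec,
      vval_mulVec, vval_CV, mval_dualTensor_mulVec, mval_dualTensor_mulVec, hnext, dotProduct_add,
      dotProduct_smul, dotProduct_smul, dotProduct_smul, dotProduct_smul, hn, val_mul, after,
      hval e x, dotProduct_comm (M.eval w e x)]
    simp only [hκ, smul_eq_mul]
    ring
  rw [formTstar_eq, Finset.sum_congr rfl fun e _ => hedge e] at hform
  have hzero := fun e => (Finset.sum_eq_zero_iff_of_nonneg fun e _ =>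
    edgeInt_mul_self_nonneg (M.dualSym e) _).1 hform e (Finset.mem_univ e)
  have hpt : ∀ e i, ∀ s ∈ Set.Icc (0 : ℝ) 1, (w e i).eval s = 0 := by
    intro e i s hs
    have h1 := val_lineMap_eq_zero_of_edgeInt (M.center_ne_vertex e) (hzero e) hs
    have hκ0 : κ e ≠ 0 := mul_ne_zero (left_ne_zero_of_mul_eq_one (N.sign_after_sq e))
      (N.primalDir_dotProduct_dual_ne_zero e)
    rw [hval] at h1
    have h2 := (mul_eq_zero.1 h1).resolve_left hκ0
    have h3 := hw.2 e (AffineMap.lineMap (M.center e.1) (M.vertex e.1 e.2) s) (by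
      change _ ∈ edgeSet s(M.center e.1, M.vertex e.1 e.2)
      rw [edgeSet_mk, segment_eq_image_lineMap]
      exact ⟨s, hs, rfl⟩)
    simp only [Mesh.eval, edgeParam_lineMap (M.center_ne_vertex e), dotProduct, Fin.sum_univ_two]
      at h2 h3
    -- `w` is orthogonal to the normals of both dual edges of the triangle, which are independent.
    have hc := N.cross_ne_zero e
    fin_cases i
    · apply mul_left_cancel₀ hc
      simp only [cross, Fin.zero_eta]
      linear_combination N.dual (M.next e) 1 * h3 - N.dual e 1 * h2
    · apply mul_left_cancel₀ hc
      simp only [cross, Fin.mk_one]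
      linear_combination N.dual e 0 * h2 - N.dual (M.next e) 0 * h3
  funext e i
  exact Polynomial.eq_zero_of_infinite_isRoot _
    ((Set.Icc_infinite zero_lt_one).mono fun s hs => hpt e i s hs)

end EdgeNormals

end Mesh

namespace Mesh

variable {Ω : Set Plane} {M : Mesh Ω}

/-! ### Integrability on the triangles -/

/-- A closed triangle may meet the boundary of `Ω`, but the frontier of a convex set is null and the
interior lies in `Ω`. -/
theorem restrict_triSet_le (hΩ : IsPolygonalDomain Ω) (τ : M.Tri) :
    volume.restrict (M.triSet τ) ≤ volume.restrict Ω := by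
  have h : volume (frontier (M.triSet τ)) = 0 := (convex_convexHull ℝ _).addHaar_frontier volume
  rw [← Measure.restrict_congr_set (interior_ae_eq_of_null_frontier h)]
  exact Measure.restrict_mono (M.interior_triSet_subset hΩ τ) le_rfl

theorem integrableOn_of_memLp (hΩ : IsPolygonalDomain Ω) {h : Plane → ℝ}
    (hh : MemLp h 2 (volume.restrict Ω)) (τ : M.Tri) : IntegrableOn h (M.triSet τ) := by
  have : IsFiniteMeasure (volume.restrict (M.triSet τ)) :=
    isFiniteMeasure_restrict.2 (M.isCompact_triSet τ).measure_lt_top.ne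
  exact (hh.mono_measure (restrict_triSet_le hΩ τ)).integrable one_le_two

theorem integrableOn_of_bounds (hΩ : IsPolygonalDomain Ω) {α : Plane → ℝ} {m m' : ℝ}
    (hαm : AEStronglyMeasurable α (volume.restrict Ω))
    (hα : ∀ᵐ x ∂volume.restrict Ω, m ≤ α x ∧ α x ≤ m') (τ : M.Tri) :
    IntegrableOn α (M.triSet τ) := by
  have : IsFiniteMeasure (volume.restrict (M.triSet τ)) :=
    isFiniteMeasure_restrict.2 (M.isCompact_triSet τ).measure_lt_top.ne
  refine Integrable.of_bound (hαm.mono_measure (restrict_triSet_le hΩ τ)) (max |m| |m'|) ?_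
  filter_upwards [ae_mono (restrict_triSet_le hΩ τ) hα] with x hx
  exact abs_le_max_abs_abs hx.1 hx.2

/-! ### Finite dimension of the discrete spaces -/

instance finite_degreeLE (k : ℕ) : Module.Finite ℝ (Polynomial.degreeLE ℝ (k : WithBot ℕ)) := by
  rw [Polynomial.degreeLE_eq_span_X_pow]
  exact Module.Finite.span_finset ℝ _

instance finite_velocitySpace (N : M.EdgeNormals) (k : ℕ) :
    Module.Finite ℝ (N.velocitySpace k) := by
  let F : N.velocitySpace k →ₗ[ℝ]
      (M.Tri → Fin 2 → MvPolynomial.restrictTotalDegree (Fin 2) ℝ k) :=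
    { toFun := fun v τ i => ⟨v.1 τ i, v.2.1 τ i⟩
      map_add' := fun _ _ => rfl
      map_smul' := fun _ _ => rfl }
  refine Module.Finite.of_injective F fun v w h => Subtype.ext (funext fun τ => funext fun i => ?_)
  exact congrArg Subtype.val (congrFun (congrFun h τ) i)

instance finite_gradientSpace (N : M.EdgeNormals) (k : ℕ) :
    Module.Finite ℝ (N.gradientSpace k) := by
  let F : N.gradientSpace k →ₗ[ℝ]
      (M.Tri → Fin 2 → Fin 2 → MvPolynomial.restrictTotalDegree (Fin 2) ℝ k) :=
    { toFun := fun G τ i j => ⟨G.1 τ i j, G.2.1 τ i j⟩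
      map_add' := fun _ _ => rfl
      map_smul' := fun _ _ => rfl }
  refine Module.Finite.of_injective F fun v w h =>
    Subtype.ext (funext fun τ => funext fun i => funext fun j => ?_)
  exact congrArg Subtype.val (congrFun (congrFun (congrFun h τ) i) j)

instance finite_traceSpace (N : M.EdgeNormals) (k : ℕ) :
    Module.Finite ℝ (N.traceSpace k) := by
  let F : N.traceSpace k →ₗ[ℝ]
      (M.DualEdge → Fin 2 → Polynomial.degreeLE ℝ (k : WithBot ℕ)) :=
    { toFun := fun v τ i => ⟨v.1 τ i, v.2.1 τ i⟩
      map_add' := fun _ _ => rfl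
      map_smul' := fun _ _ => rfl }
  refine Module.Finite.of_injective F fun v w h => Subtype.ext (funext fun τ => funext fun i => ?_)
  exact congrArg Subtype.val (congrFun (congrFun h τ) i)

instance finite_pressureSpace (M : Mesh Ω) (k : ℕ) : Module.Finite ℝ (M.pressureSpace k) := by
  let F : M.pressureSpace k →ₗ[ℝ] (M.Tri → MvPolynomial.restrictTotalDegree (Fin 2) ℝ k) :=
    { toFun := fun q τ => ⟨q.1 τ, q.2.1 τ⟩
      map_add' := fun _ _ => rfl
      map_smul' := fun _ _ => rfl }
  refine Module.Finite.of_injective F fun v w h => Subtype.ext (funext fun τ => ?_)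
  exact congrArg Subtype.val (congrFun h τ)

/-! ### The forms as bilinear maps -/

/-- The inner product `(L, G)` of tensor fields. -/
def tensorInner (M : Mesh Ω) : M.TensorField →ₗ[ℝ] M.TensorField →ₗ[ℝ] ℝ :=
  LinearMap.mk₂ ℝ (fun L G => ∑ τ, M.triInt τ (∑ i, ∑ j, L τ i j * G τ i j))
    (fun L L' G => by
      simp only [Pi.add_apply, Matrix.add_apply, add_mul, Finset.sum_add_distrib, map_add])
    (fun r L G => by
      simp only [Pi.smul_apply, Matrix.smul_apply, smul_mul_assoc, ← Finset.smul_sum, map_smul])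
    (fun L G G' => by
      simp only [Pi.add_apply, Matrix.add_apply, mul_add, Finset.sum_add_distrib, map_add])
    (fun r L G => by
      simp only [Pi.smul_apply, Matrix.smul_apply, mul_smul_comm, ← Finset.smul_sum, map_smul])

theorem tensorInner_apply (L G : M.TensorField) : M.tensorInner L G =
    M.integral (fun τ x => ddot (mval (L τ) x) (mval (G τ) x)) := by
  rw [M.integral_eq_sum (P := fun τ => ∑ i, ∑ j, L τ i j * G τ i j)]
  · rfl
  · intro τ x
    simp only [ddot, mval, val_sum, val_mul, of_apply]

/-- The weighted inner product `(α u, v)` of vector fields. -/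
def weightedInner {α : Plane → ℝ} (hα : ∀ τ : M.Tri, IntegrableOn α (M.triSet τ)) :
    M.VectorField →ₗ[ℝ] M.VectorField →ₗ[ℝ] ℝ :=
  LinearMap.mk₂ ℝ (fun u v => ∑ τ, M.weightInt τ α (hα τ) (u τ ⬝ᵥ v τ))
    (fun u u' v => by
      simp only [Pi.add_apply, add_dotProduct, Finset.sum_add_distrib, map_add])
    (fun r u v => by
      simp only [Pi.smul_apply, smul_dotProduct, ← Finset.smul_sum, map_smul])
    (fun u v v' => by
      simp only [Pi.add_apply, dotProduct_add, Finset.sum_add_distrib, map_add])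
    (fun r u v => by
      simp only [Pi.smul_apply, dotProduct_smul, ← Finset.smul_sum, map_smul])

theorem weightedInner_apply {α : Plane → ℝ} (hα : ∀ τ : M.Tri, IntegrableOn α (M.triSet τ))
    (u v : M.VectorField) : weightedInner hα u v =
      M.integral (fun τ x => (α x • vval (u τ) x) ⬝ᵥ vval (v τ) x) := by
  simp only [integral, smul_dotProduct, smul_eq_mul, ← val_dotProduct]
  rfl

/-- The functional `v ↦ (f, v)`. -/
def vectorLoad {f : Plane → Fin 2 → ℝ}
    (hf : ∀ (τ : M.Tri) i, IntegrableOn (fun x => f x i) (M.triSet τ)) :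
    M.VectorField →ₗ[ℝ] ℝ :=
  ∑ τ, ∑ i, M.weightInt τ (fun x => f x i) (hf τ i) ∘ₗ LinearMap.proj i ∘ₗ LinearMap.proj τ

theorem vectorLoad_apply {f : Plane → Fin 2 → ℝ}
    (hf : ∀ (τ : M.Tri) i, IntegrableOn (fun x => f x i) (M.triSet τ)) (v : M.VectorField) :
    vectorLoad hf v = M.integral (fun τ x => f x ⬝ᵥ vval (v τ) x) := by
  simp only [vectorLoad, LinearMap.sum_apply, integral, dotProduct, vval]
  refine Finset.sum_congr rfl fun τ _ => ?_
  rw [integral_finsetSum]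
  · rfl
  · intro i _
    exact (hf τ i).mul_continuousOn (continuous_val _).continuousOn (M.isCompact_triSet τ)

/-- The functional `q ↦ (g, q)`. -/
def scalarLoad {g : Plane → ℝ} (hg : ∀ τ : M.Tri, IntegrableOn g (M.triSet τ)) :
    M.ScalarField →ₗ[ℝ] ℝ :=
  ∑ τ, M.weightInt τ g (hg τ) ∘ₗ LinearMap.proj τ

theorem scalarLoad_apply {g : Plane → ℝ} (hg : ∀ τ : M.Tri, IntegrableOn g (M.triSet τ))
    (q : M.ScalarField) : scalarLoad hg q = M.integral (fun τ x => g x * val (q τ) x) := by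
  simp only [scalarLoad, LinearMap.sum_apply, integral]
  rfl

namespace EdgeNormals

variable (N : M.EdgeNormals)

theorem jumpDual_add {V : Type} [AddCommGroup V] [Module ℝ V] (φ ψ : M.Tri → V) (e : M.DualEdge) :
    N.jumpDual (fun τ => φ τ + ψ τ) e = N.jumpDual φ e + N.jumpDual ψ e := by
  simp only [jumpDual, smul_add]; abel

theorem jumpDual_smul {V : Type} [AddCommGroup V] [Module ℝ V] (r : ℝ) (φ : M.Tri → V)
    (e : M.DualEdge) : N.jumpDual (fun τ => r • φ τ) e = r • N.jumpDual φ e := by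
  simp only [jumpDual, smul_add, smul_comm r]

theorem mdvg_add (G H : Matrix (Fin 2) (Fin 2) Poly) : mdvg (G + H) = mdvg G + mdvg H := by
  funext i; simp [mdvg]; ring

theorem mdvg_smul (r : ℝ) (G : Matrix (Fin 2) (Fin 2) Poly) : mdvg (r • G) = r • mdvg G := by
  funext i; simp [mdvg]

theorem grad_add (p q : Poly) : grad (p + q) = grad p + grad q := by
  funext i; simp [grad]

theorem grad_smul (r : ℝ) (p : Poly) : grad (r • p) = r • grad p := by
  funext i; simp [grad]

theorem extendField_add (w z : M.EdgeField) (e : M.DualEdge) :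
    extendField (w + z) e = extendField w e + extendField z e := by
  funext i; simp [extendField, extend]

theorem extendField_smul (r : ℝ) (w : M.EdgeField) (e : M.DualEdge) :
    extendField (r • w) e = r • extendField w e := by
  funext i; simp [extendField, extend]

/-- `B_h^*` as a bilinear map. -/
def bilinBstar : M.VectorField →ₗ[ℝ] M.TensorField →ₗ[ℝ] ℝ :=
  LinearMap.mk₂ ℝ N.formBstar
    (fun u v G => by
      simp only [formBstar_eq, Pi.add_apply, add_dotProduct, add_mul, Finset.sum_add_distrib,
        map_add]
      ring)
    (fun r v G => by
      simp only [formBstar_eq, Pi.smul_apply, smul_dotProduct, smul_mul_assoc,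
        ← Finset.smul_sum, map_smul, smul_add, smul_neg])
    (fun v G H => by
      simp only [formBstar_eq, Pi.add_apply, mdvg_add, add_mulVec, jumpDual_add, dotProduct_add,
        mul_add, Finset.sum_add_distrib, map_add]
      ring)
    (fun r v G => by
      simp only [formBstar_eq, Pi.smul_apply, mdvg_smul, smul_mulVec, jumpDual_smul,
        dotProduct_smul, mul_smul_comm, ← Finset.smul_sum, map_smul, smul_add, smul_neg])

/-- `b_h` as a bilinear map. -/
def bilinb : M.VectorField →ₗ[ℝ] M.ScalarField →ₗ[ℝ] ℝ :=
  LinearMap.mk₂ ℝ N.formb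
    (fun u v G => by
      simp only [formb_eq, Pi.add_apply, add_dotProduct, add_mul, Finset.sum_add_distrib,
        map_add]
      ring)
    (fun r v G => by
      simp only [formb_eq, Pi.smul_apply, smul_dotProduct, smul_mul_assoc,
        ← Finset.smul_sum, map_smul, smul_sub])
    (fun v p q => by
      have : ∀ e, N.jumpDual (p + q) e = N.jumpDual p e + N.jumpDual q e := N.jumpDual_add p q
      simp only [formb_eq, Pi.add_apply, grad_add, this, dotProduct_add,
        mul_add, Finset.sum_add_distrib, map_add]
      ring)
    (fun r v q => by
      have : ∀ e, N.jumpDual (r • q) e = r • N.jumpDual q e := N.jumpDual_smul r q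
      simp only [formb_eq, Pi.smul_apply, grad_smul, this,
        dotProduct_smul, mul_smul_comm, ← Finset.smul_sum, map_smul, smul_sub])

/-- `T_h^*` as a bilinear map. -/
def bilinTstar : M.EdgeField →ₗ[ℝ] M.TensorField →ₗ[ℝ] ℝ :=
  LinearMap.mk₂ ℝ N.formTstar
    (fun u v G => by
      simp only [formTstar_eq, extendField_add, add_dotProduct, Finset.sum_add_distrib, map_add])
    (fun r v G => by
      simp only [formTstar_eq, extendField_smul, smul_dotProduct, ← Finset.smul_sum, map_smul])
    (fun v G H => by
      simp only [formTstar_eq, Pi.add_apply, add_mulVec, jumpDual_add, dotProduct_add,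
        Finset.sum_add_distrib, map_add])
    (fun r v G => by
      simp only [formTstar_eq, Pi.smul_apply, smul_mulVec, jumpDual_smul,
        dotProduct_smul, ← Finset.smul_sum, map_smul])

theorem bilinBstar_apply (v : M.VectorField) (G : M.TensorField) :
    N.bilinBstar v G = N.formBstar v G := rfl

theorem bilinb_apply (v : M.VectorField) (q : M.ScalarField) : N.bilinb v q = N.formb v q := rfl

theorem bilinTstar_apply (w : M.EdgeField) (G : M.TensorField) :
    N.bilinTstar w G = N.formTstar w G := rfl

/-- The product of the discrete spaces. -/
abbrev DiscreteSpace (k : ℕ) : Type :=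
  N.gradientSpace k × N.velocitySpace k × N.traceSpace k × M.pressureSpace k

/-- The bilinear form of the discrete system. -/
def systemForm (k : ℕ) (ε : ℝ) {α : Plane → ℝ} (hα : ∀ τ : M.Tri, IntegrableOn α (M.triSet τ)) :
    N.DiscreteSpace k →ₗ[ℝ] N.DiscreteSpace k →ₗ[ℝ] ℝ :=
  LinearMap.mk₂ ℝ (fun s t =>
      -- `B_h` and `b_h^*` are written through their adjoints, so that the cancellation on the
      -- diagonal is visible. The trace equation enters without the factor `√ε`.
      (M.tensorInner s.1.1 t.1.1 - √ε * N.bilinBstar s.2.1.1 t.1.1 -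
        √ε * N.bilinTstar s.2.2.1.1 t.1.1) +
      (√ε * N.bilinBstar t.2.1.1 s.1.1 + weightedInner hα s.2.1.1 t.2.1.1 +
        N.bilinb t.2.1.1 s.2.2.2.1) -
      N.bilinb s.2.1.1 t.2.2.2.1 + N.bilinTstar t.2.2.1.1 s.1.1)
    (fun s s' t => by
      simp only [Prod.fst_add, Prod.snd_add, Submodule.coe_add, map_add, LinearMap.add_apply]
      ring)
    (fun r s t => by
      simp only [Prod.smul_fst, Prod.smul_snd, Submodule.coe_smul, map_smul, LinearMap.smul_apply,
        smul_eq_mul]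
      ring)
    (fun s t t' => by
      simp only [Prod.fst_add, Prod.snd_add, Submodule.coe_add, map_add, LinearMap.add_apply]
      ring)
    (fun r s t => by
      simp only [Prod.smul_fst, Prod.smul_snd, Submodule.coe_smul, map_smul, LinearMap.smul_apply,
        smul_eq_mul]
      ring)

/-- The right-hand side of the discrete system. -/
def systemLoad (k : ℕ) {f : Plane → Fin 2 → ℝ} {g : Plane → ℝ}
    (hf : ∀ (τ : M.Tri) i, IntegrableOn (fun x => f x i) (M.triSet τ))
    (hg : ∀ τ : M.Tri, IntegrableOn g (M.triSet τ)) : N.DiscreteSpace k →ₗ[ℝ] ℝ where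
  toFun t := vectorLoad hf t.2.1.1 + scalarLoad hg t.2.2.2.1
  map_add' s t := by
    simp only [Prod.fst_add, Prod.snd_add, Submodule.coe_add, map_add]
    ring
  map_smul' r s := by
    simp only [Prod.smul_fst, Prod.smul_snd, Submodule.coe_smul, map_smul, smul_eq_mul,
      RingHom.id_apply]
    ring

/-- The summed equation gives back the four equations by test elements with a single nonzero
component; discrete integration by parts restores the original forms. -/
theorem isSolution_iff {k : ℕ} {ε : ℝ} {α : Plane → ℝ} {f : Plane → Fin 2 → ℝ} {g : Plane → ℝ}
    (hα : ∀ τ : M.Tri, IntegrableOn α (M.triSet τ))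
    (hf : ∀ (τ : M.Tri) i, IntegrableOn (fun x => f x i) (M.triSet τ))
    (hg : ∀ τ : M.Tri, IntegrableOn g (M.triSet τ)) (s : N.DiscreteSpace k) :
    N.IsSolution k ε α f g s.1 s.2.1 s.2.2.1 s.2.2.2 ↔
      N.systemForm k ε hα s = N.systemLoad k hf hg := by
  have hform : ∀ t, N.systemForm k ε hα s t =
      (M.integral (fun τ x => ddot (mval (s.1.1 τ) x) (mval (t.1.1 τ) x)) -
        √ε * N.formBstar s.2.1 t.1 - √ε * N.formTstar s.2.2.1 t.1) +
      (√ε * N.formB s.1 t.2.1 +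
        M.integral (fun τ x => (α x • vval (s.2.1.1 τ) x) ⬝ᵥ vval (t.2.1.1 τ) x) +
        N.formbstar s.2.2.2 t.2.1) - N.formb s.2.1 t.2.2.2 + N.formT s.1 t.2.2.1 := by
    intro t
    rw [N.formB_eq_formBstar t.2.1.2 s.1.2, N.formbstar_eq_formb t.2.1.2 s.2.2.2.2,
      formT_eq_formTstar, ← tensorInner_apply, ← weightedInner_apply hα]
    rfl
  have hload : ∀ t, N.systemLoad k hf hg t =
      M.integral (fun τ x => f x ⬝ᵥ vval (t.2.1.1 τ) x) +
        M.integral (fun τ x => g x * val (t.2.2.2.1 τ) x) := by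
    intro t
    rw [← vectorLoad_apply hf, ← scalarLoad_apply hg]
    rfl
  constructor
  · intro h
    refine LinearMap.ext fun t => ?_
    rw [hform, hload]
    linear_combination h.eq_gradient t.1 + h.eq_momentum t.2.1 + h.eq_mass t.2.2.2 +
      h.eq_trace t.2.2.1
  · intro h
    have key : ∀ t : N.DiscreteSpace k,
        (M.tensorInner s.1.1 t.1.1 - √ε * N.bilinBstar s.2.1.1 t.1.1 -
          √ε * N.bilinTstar s.2.2.1.1 t.1.1) +
        (√ε * N.bilinBstar t.2.1.1 s.1.1 + weightedInner hα s.2.1.1 t.2.1.1 +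
          N.bilinb t.2.1.1 s.2.2.2.1) -
        N.bilinb s.2.1.1 t.2.2.2.1 + N.bilinTstar t.2.2.1.1 s.1.1 =
        vectorLoad hf t.2.1.1 + scalarLoad hg t.2.2.2.1 := fun t => LinearMap.congr_fun h t
    constructor
    · intro G
      have := key (G, 0, 0, 0)
      simp only [Submodule.coe_zero, map_zero, LinearMap.zero_apply] at this
      rw [← tensorInner_apply, ← bilinBstar_apply, ← bilinTstar_apply]
      linear_combination this
    · intro v
      have := key (0, v, 0, 0)
      simp only [Submodule.coe_zero, map_zero, LinearMap.zero_apply] at this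
      rw [N.formB_eq_formBstar v.2 s.1.2, N.formbstar_eq_formb v.2 s.2.2.2.2,
        ← weightedInner_apply hα, ← vectorLoad_apply hf, ← bilinBstar_apply, ← bilinb_apply]
      linear_combination this
    · intro q
      have := key (0, 0, 0, q)
      simp only [Submodule.coe_zero, map_zero, LinearMap.zero_apply] at this
      rw [← scalarLoad_apply hg, ← bilinb_apply]
      linear_combination this
    · intro z
      have := key (0, 0, z, 0)
      simp only [Submodule.coe_zero, map_zero, LinearMap.zero_apply] at this
      rw [formT_eq_formTstar, ← bilinTstar_apply]
      linear_combination this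

/-! ### Uniqueness -/

theorem tensorInner_self_nonneg (L : M.TensorField) : 0 ≤ M.tensorInner L L := by
  refine Finset.sum_nonneg fun τ _ => triInt_nonneg fun x _ => ?_
  simp only [val_sum, val_mul]
  exact Finset.sum_nonneg fun i _ => Finset.sum_nonneg fun j _ => mul_self_nonneg _

theorem eq_zero_of_tensorInner_self {L : M.TensorField} (h : M.tensorInner L L = 0) : L = 0 := by
  have hpos : ∀ τ, ∀ x ∈ M.triSet τ, 0 ≤ val (∑ i, ∑ j, L τ i j * L τ i j) x := by
    intro τ x _
    simp only [val_sum, val_mul]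
    exact Finset.sum_nonneg fun i _ => Finset.sum_nonneg fun j _ => mul_self_nonneg _
  funext τ
  have hz := (Finset.sum_eq_zero_iff_of_nonneg fun τ _ => triInt_nonneg (hpos τ)).1 h τ
    (Finset.mem_univ τ)
  ext1 i j
  refine poly_eq_zero_of_openTri (τ := τ) fun x hx => ?_
  have h0 := val_eq_zero_of_triInt (hpos τ) hz x hx
  simp only [val_sum, val_mul] at h0
  have h1 := (Finset.sum_eq_zero_iff_of_nonneg fun i _ =>
    Finset.sum_nonneg fun j _ => mul_self_nonneg _).1 h0 i (Finset.mem_univ i)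
  exact mul_self_eq_zero.1 ((Finset.sum_eq_zero_iff_of_nonneg fun j _ =>
    mul_self_nonneg _).1 h1 j (Finset.mem_univ j))

theorem le_weightedInner_self {α : Plane → ℝ} (hα : ∀ τ : M.Tri, IntegrableOn α (M.triSet τ))
    {m : ℝ} (hm : ∀ τ : M.Tri, ∀ᵐ x ∂volume.restrict (M.triSet τ), m ≤ α x) (u : M.VectorField) :
    m * ∑ τ, M.triInt τ (u τ ⬝ᵥ u τ) ≤ weightedInner hα u u := by
  rw [Finset.mul_sum]
  refine Finset.sum_le_sum fun τ _ => ?_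
  rw [triInt_apply, ← integral_const_mul]
  refine integral_mono_ae ((M.integrableOn_val _ τ).const_mul m)
    ((hα τ).mul_continuousOn (continuous_val _).continuousOn (M.isCompact_triSet τ)) ?_
  filter_upwards [hm τ] with x hx
  refine mul_le_mul_of_nonneg_right hx ?_
  rw [val_dotProduct]
  exact Finset.sum_nonneg fun i _ => mul_self_nonneg _

theorem sum_triInt_dotProduct_self_nonneg (u : M.VectorField) :
    0 ≤ ∑ τ, M.triInt τ (u τ ⬝ᵥ u τ) := by
  refine Finset.sum_nonneg fun τ _ => triInt_nonneg fun x _ => ?_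
  rw [val_dotProduct]
  exact Finset.sum_nonneg fun i _ => mul_self_nonneg _

theorem eq_zero_of_sum_triInt_dotProduct_self {u : M.VectorField}
    (h : ∑ τ, M.triInt τ (u τ ⬝ᵥ u τ) = 0) : u = 0 := by
  have hpos : ∀ τ, ∀ x ∈ M.triSet τ, 0 ≤ val (u τ ⬝ᵥ u τ) x := by
    intro τ x _
    rw [val_dotProduct]
    exact Finset.sum_nonneg fun i _ => mul_self_nonneg _
  funext τ i
  have hz := (Finset.sum_eq_zero_iff_of_nonneg fun τ _ => triInt_nonneg (hpos τ)).1 h τ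
    (Finset.mem_univ τ)
  refine poly_eq_zero_of_openTri (τ := τ) fun x hx => ?_
  have h0 := val_eq_zero_of_triInt (hpos τ) hz x hx
  rw [val_dotProduct] at h0
  exact mul_self_eq_zero.1 ((Finset.sum_eq_zero_iff_of_nonneg fun j _ =>
    mul_self_nonneg _).1 h0 i (Finset.mem_univ i))

/-- The energy identity kills `L` and `u`; the momentum and gradient equations then say that `p` and
`w` lie in the kernels treated above. -/
theorem systemForm_injective (hΩ : IsPolygonalDomain Ω) (k : ℕ) {ε : ℝ} (hε : 0 < ε)
    {α : Plane → ℝ} (hα : ∀ τ : M.Tri, IntegrableOn α (M.triSet τ)) {m : ℝ} (hm0 : 0 < m)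
    (hm : ∀ τ : M.Tri, ∀ᵐ x ∂volume.restrict (M.triSet τ), m ≤ α x) :
    Function.Injective (N.systemForm k ε hα) := by
  rw [injective_iff_map_eq_zero]
  rintro ⟨L, u, w, p⟩ hs
  have key : ∀ t : N.DiscreteSpace k,
      (M.tensorInner L.1 t.1.1 - √ε * N.bilinBstar u.1 t.1.1 -
        √ε * N.bilinTstar w.1 t.1.1) +
      (√ε * N.bilinBstar t.2.1.1 L.1 + weightedInner hα u.1 t.2.1.1 +
        N.bilinb t.2.1.1 p.1) -
      N.bilinb u.1 t.2.2.2.1 + N.bilinTstar t.2.2.1.1 L.1 = 0 := fun t => LinearMap.congr_fun hs t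
  have hT : N.bilinTstar w.1 L.1 = 0 := by
    have := key (0, 0, w, 0)
    simp only [Submodule.coe_zero, map_zero, LinearMap.zero_apply] at this
    linear_combination this
  -- On the diagonal the `B` and `b` terms cancel, but the trace terms leave `(1 - √ε) T_h^*(w, L)`,
  -- which `hT` removes.
  have henergy : M.tensorInner L.1 L.1 + weightedInner hα u.1 u.1 = 0 := by
    have := key (L, u, w, p)
    simp only at this
    linear_combination this + (√ε - 1) * hT
  have hw := le_weightedInner_self hα hm u.1
  have hn1 := tensorInner_self_nonneg L.1
  have hn2 := sum_triInt_dotProduct_self_nonneg u.1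
  have hn3 := mul_nonneg hm0.le hn2
  have hL : L = 0 := Subtype.ext (eq_zero_of_tensorInner_self (by linarith))
  have hu : u = 0 := by
    refine Subtype.ext (eq_zero_of_sum_triInt_dotProduct_self ?_)
    exact (mul_eq_zero.1 (by linarith : m * ∑ τ, M.triInt τ (u.1 τ ⬝ᵥ u.1 τ) = 0)).resolve_left
      hm0.ne'
  subst hL hu
  have hp : p = 0 := by
    refine Subtype.ext (N.pressure_eq_zero_of_formb hΩ p.2 fun v hv => ?_)
    have := key (0, ⟨v, hv⟩, 0, 0)
    simp only [Submodule.coe_zero, map_zero, LinearMap.zero_apply] at this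
    rw [← bilinb_apply]
    linear_combination this
  have hw0 : w = 0 := by
    refine Subtype.ext (N.trace_eq_zero_of_formTstar w.2 fun G hG => ?_)
    have := key (⟨G, hG⟩, 0, 0, 0)
    simp only [Submodule.coe_zero, map_zero, LinearMap.zero_apply] at this
    have hse : √ε ≠ 0 := (Real.sqrt_pos.2 hε).ne'
    rw [← bilinTstar_apply]
    exact (mul_eq_zero.1 (by linear_combination -this :
      √ε * N.bilinTstar w.1 G = 0)).resolve_left hse
  rw [hp, hw0]
  rfl

end EdgeNormals

end Mesh

end SDG

end

/-! ### Existence and uniqueness for the discrete system -/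

theorem theorem3p2 (Ω : Set SDG.Plane) (hΩ : SDG.IsPolygonalDomain Ω)
    (M : SDG.Mesh Ω) (N : M.EdgeNormals) (k : ℕ)
    (ε : ℝ) (hε : 0 < ε)
    (α : SDG.Plane → ℝ) (αmin αmax : ℝ) (hαmin : 0 < αmin)
    (hαm : AEStronglyMeasurable α (volume.restrict Ω))
    (hα : ∀ᵐ x ∂volume.restrict Ω, αmin ≤ α x ∧ α x ≤ αmax)
    (f : SDG.Plane → Fin 2 → ℝ) (hf : ∀ i, MemLp (fun x => f x i) 2 (volume.restrict Ω))
    (g : SDG.Plane → ℝ) (hg : MemLp g 2 (volume.restrict Ω)) :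
    ∃! s : N.gradientSpace k × N.velocitySpace k × N.traceSpace k × M.pressureSpace k,
      N.IsSolution k ε α f g s.1 s.2.1 s.2.2.1 s.2.2.2 := by
  have hα' : ∀ τ : M.Tri, IntegrableOn α (M.triSet τ) :=
    SDG.Mesh.integrableOn_of_bounds hΩ hαm hα
  have hf' : ∀ (τ : M.Tri) i, IntegrableOn (fun x => f x i) (M.triSet τ) := fun τ i =>
    SDG.Mesh.integrableOn_of_memLp hΩ (hf i) τ
  have hg' : ∀ τ : M.Tri, IntegrableOn g (M.triSet τ) := SDG.Mesh.integrableOn_of_memLp hΩ hg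
  have hinj := N.systemForm_injective hΩ k hε hα' hαmin fun τ => by
    filter_upwards [ae_mono (SDG.Mesh.restrict_triSet_le hΩ τ) hα] with x hx using hx.1
  -- The form maps the discrete space to its dual, of the same finite dimension, so injectivity
  -- gives surjectivity.
  have hsurj : Function.Surjective (N.systemForm k ε hα') :=
    (LinearMap.injective_iff_surjective_of_finrank_eq_finrank
      (Subspace.dual_finrank_eq (K := ℝ) (V := N.DiscreteSpace k)).symm).1 hinj
  obtain ⟨s, hs⟩ := hsurj (N.systemLoad k hf' hg')
  refine ⟨s, (N.isSolution_iff hα' hf' hg' s).2 hs, fun t ht => hinj ?_⟩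
  rw [hs]
  exact (N.isSolution_iff hα' hf' hg' t).1 ht
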